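/- **Setting.** Let $\theta\in(0,1)$, $\alpha\in(0,1]$, and let $p,q$ be probability densities with respect to a common baseline measure $\mu$. Consider streams $k=1,2,\dots$ with change points $\tau_k$ and observations $X_{k,t}$, $t=1,2,\dots$, all on one probability space, such that for every $K$ the first $K$ streams follow the model $\mathcal M_{\mathrm s}$: $\tau_1,\dots,\tau_K$ are i.i.d. with $\mathbb P(\tau_k=m)=\theta(1-\theta)^m$, $m=0,1,\dots$, and, given $\tau_1,\dots,\tau_K$, the $X_{k,t}$ are independent over all $k,t$, with density $p$ if $t\le\tau_k$ and density $q$ if $t>\tau_k$. Assumption A1: for $Z_1$ with density $p$ and $Z_2$ with density $q$, the likelihood ratios $q(Z_1)/p(Z_1)$ and $q(Z_2)/p(Z_2)$ have densities with respect to Lebesgue measure over $\mathbb R_+=(0,\infty)$ that are continuous and strictly positive there. The procedure $\mathbb T^*_K$ for the first $K$ streams produces active sets $S^*_{K,t}$ and information $\sigma$-fields $\mathcal F^*_{K,t}$ as follows. $S^*_{K,1}=\{1,\dots,K\}$ and $\mathcal F^*_{K,1}=\sigma(X_{k,1},k\le K)$. At each time $t\ge1$ put $W_{k,t}=\mathbb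 P(\tau_k<t\mid\mathcal F^*_{K,t})$, sort $(W_{k,t})_{k\in S^*_{K,t}}$ in ascending order (ties broken by the index), and let $S^*_{K,t+1}$ consist of the first $n$ streams in this order, where $n\in\{0,\dots,|S^*_{K,t}|\}$ is the largest number for which the average of the $n$ smallest values is at most $\alpha$ (the average being $0$ for $n=0$). Then $\mathcal F^*_{K,t+1}=\sigma(\mathcal F^*_{K,t},S^*_{K,t+1},X_{k,t+1},k\in S^*_{K,t+1})$. Put $$\hat\lambda_{K,t}=\max\{W_{k,t}:k\in S^*_{K,t+1}\},\qquad \mathrm{LFNR}_{t+1}(\mathbb T^*_K)=\mathbb E\Big(\frac{\sum_{k\in S^*_{K,t+1}}\mathbf 1(\tau_k<t)}{|S^*_{K,t+1}|\vee1}\,\Big|\,\mathcal F^*_{K,t}\Big).$$ Define $V_0=0$ and $$V_{t+1}=\frac{q(X_{1,t+1})/p(X_{1,t+1})}{(1-\theta)(1-V_t)/(\theta+(1-\theta)V_t)+q(X_{1,t+1})/p(X_{1,t+1})},$$ and $\lambda_0=1$, $\lambda_t=\sup\{\lambda\in[0,1]:\mathbb E(V_t\mid V_t\le\lambda,\ V_s\le\lambda_s,\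 0\le s\le t-1)\le\alpha\}$ for $t\ge1$. **Theorem.** Under this model and Assumption A1, for each $t\ge1$: 1. $\lim_{K\to\infty}\hat\lambda_{K,t}=\lambda_t$ almost surely. 2. $\lim_{K\to\infty}\mathrm{LFNR}_{t+1}(\mathbb T^*_K)=\mathbb E(V_t\mid V_s\le\lambda_s,\ 0\le s\le t)$ almost surely. Moreover, $$\mathbb E(V_t\mid V_s\le\lambda_s,\ 0\le s\le t)=\begin{cases}1-(1-\theta)^t,& t<\dfrac{\log(1-\alpha)}{\log(1-\theta)},\\[1ex] \alpha,& t\ge\dfrac{\log(1-\alpha)}{\log(1-\theta)},\end{cases}$$ where $\log(1-\alpha)/\log(1-\theta)$ is read as $+\infty$ if $\alpha=1$. 3. $\lim_{K\to\infty}K^{-1}|S^*_{K,t+1}|=\mathbb P(V_1\le\lambda_1,\dots,V_t\le\lambda_t)$ almost surely. -/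

import Mathlib

open MeasureTheory ProbabilityTheory Filter Topology

namespace ChangePoint

/-! ### The change-point model with i.i.d. geometric change points -/

/-- `f` is a probability density with respect to the baseline measure `μ`. -/
structure IsDensity {E : Type*} [MeasurableSpace E] (μ : Measure E) (f : E → ℝ) : Prop where
  measurable : Measurable f
  nonneg : ∀ x, 0 ≤ f x
  lintegral_eq_one : ∫⁻ x, ENNReal.ofReal (f x) ∂μ = 1

/-- The probability distribution with density `f` with respect to `μ`. -/
noncomputable def densityLaw {E : Type*} [MeasurableSpace E] (μ : Measure E) (f : E → ℝ) :
    Measure E :=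
  μ.withDensity (fun x => ENNReal.ofReal (f x))

/-- The event that the change points of the `K` streams take the values `m`. -/
def changePointEvent {Ω : Type*} {K : ℕ} (τ : Fin K → Ω → ℕ∞) (m : Fin K → ℕ) : Set Ω :=
  {ω | ∀ k, τ k ω = (m k : ℕ∞)}

/-- The i.i.d. change-point model for `K` parallel streams. The change points `τ k` are i.i.d.
with `P(τ k = m) = θ (1 - θ) ^ m` for `m = 0, 1, …`. Given the change points, the observations
`X k t` (`t = 1, 2, …`) are independent over all `k` and `t`, and `X k t` has density `p` if
`t ≤ τ k` and density `q` if `t > τ k`. The value `X k 0` plays no role. -/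
structure IsModel {Ω E : Type*} [MeasurableSpace Ω] [MeasurableSpace E] (P : Measure Ω)
    (μ : Measure E) (p q : E → ℝ) (θ : ℝ) {K : ℕ}
    (τ : Fin K → Ω → ℕ∞) (X : Fin K → ℕ → Ω → E) : Prop where
  density_pre : IsDensity μ p
  density_post : IsDensity μ q
  theta_pos : 0 < θ
  theta_lt_one : θ < 1
  measurable_changePoint : ∀ k, Measurable (τ k)
  measurable_obs : ∀ k t, 1 ≤ t → Measurable (X k t)
  indep_changePoint : iIndepFun τ P
  law_changePoint : ∀ k (m : ℕ),
    P {ω | τ k ω = (m : ℕ∞)} = ENNReal.ofReal (θ * (1 - θ) ^ m)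
  indep_obs : ∀ m : Fin K → ℕ,
    iIndepFun (fun (i : Fin K × ℕ) => X i.1 (i.2 + 1)) (cond P (changePointEvent τ m))
  law_obs : ∀ (m : Fin K → ℕ) (k : Fin K) (t : ℕ), 1 ≤ t →
    (cond P (changePointEvent τ m)).map (X k t) =
      if t ≤ m k then densityLaw μ p else densityLaw μ q

/-- The measure `ν` on `ℝ` has a continuous and strictly positive density over the positive half
line, with respect to Lebesgue measure. -/
def HasContPosDensity (ν : Measure ℝ) : Prop :=
  ∃ f : ℝ → ℝ, ContinuousOn f (Set.Ioi 0) ∧ (∀ z, 0 < z → 0 < f z) ∧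
    ν = (volume.restrict (Set.Ioi 0)).withDensity (fun z => ENNReal.ofReal (f z))

/-- The likelihood ratio `q / p` has a continuous and strictly positive density over the positive
half line, both under `p` and under `q`. -/
def LikelihoodRatioAssumption {E : Type*} [MeasurableSpace E] (μ : Measure E)
    (p q : E → ℝ) : Prop :=
  HasContPosDensity ((densityLaw μ p).map fun x => q x / p x) ∧
    HasContPosDensity ((densityLaw μ q).map fun x => q x / p x)

/-! ### The one-step update rule -/

/-- The number of elements of `S` that come strictly before `k` when `S` is sorted by increasing
value of `w`, ties being broken by the index. -/
noncomputable def rank {K : ℕ} (S : Finset (Fin K)) (w : Fin K → ℝ) (k : Fin K) : ℕ :=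
  (S.filter fun j => w j < w k ∨ (w j = w k ∧ j < k)).card

/-- The first `n` elements of `S` when `S` is sorted by increasing value of `w`, ties being broken
by the index. -/
noncomputable def smallest {K : ℕ} (S : Finset (Fin K)) (w : Fin K → ℝ) (n : ℕ) :
    Finset (Fin K) :=
  S.filter fun k => rank S w k < n

/-- The average of the `n` smallest values of `w` on `S`; it is `0` for `n = 0`. -/
noncomputable def cumulativeAverage {K : ℕ} (S : Finset (Fin K)) (w : Fin K → ℝ) (n : ℕ) : ℝ :=
  (∑ k ∈ smallest S w n, w k) / n

/-- One-step update: keep the first `n` streams of `S`, for the largest `n ∈ {0, …, |S|}` for which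
the average of their posterior probabilities is at most `α`. -/
noncomputable def oneStepUpdate {K : ℕ} (α : ℝ) (S : Finset (Fin K)) (w : Fin K → ℝ) :
    Finset (Fin K) :=
  smallest S w (Nat.findGreatest (fun n => cumulativeAverage S w n ≤ α) S.card)

/-! ### The proposed procedure -/

/-- The posterior probability, given `F`, that stream `k` has changed strictly before time `t`. -/
noncomputable def postProb {Ω : Type*} [MeasurableSpace Ω] (P : Measure Ω) {K : ℕ}
    (τ : Fin K → Ω → ℕ∞) (F : MeasurableSpace Ω) (k : Fin K) (t : ℕ) : Ω → ℝ :=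
  condExp F P (Set.indicator {ω | τ k ω < (t : ℕ∞)} fun _ => (1 : ℝ))

/-- The σ-algebra `σ(F, S, X_k, k ∈ S)`: the information in `F`, together with the random index
set `S` and the values of `X_k` for the indices `k` that lie in `S`. -/
@[reducible]
def observe {Ω E : Type*} [MeasurableSpace E] {K : ℕ} (F : MeasurableSpace Ω)
    (S : Ω → Finset (Fin K)) (X : Fin K → Ω → E) : MeasurableSpace Ω :=
  F ⊔ MeasurableSpace.comap S ⊤ ⊔
    MeasurableSpace.generateFrom
      {A | ∃ (k : Fin K) (B : Set E), MeasurableSet B ∧ A = {ω | k ∈ S ω ∧ X k ω ∈ B}}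

/-- The pair `(F_t, S_{t+1})` of the proposed procedure: `F_0` is trivial, `S_1` consists of all
streams, `F_{t+1} = σ(F_t, S_{t+1}, X_{k,t+1}, k ∈ S_{t+1})`, and `S_{t+2}` is the one-step update
of `S_{t+1}` based on the posterior probabilities given `F_{t+1}`. -/
noncomputable def procedure {Ω E : Type*} [MeasurableSpace Ω] [MeasurableSpace E]
    (P : Measure Ω) (α : ℝ) {K : ℕ} (τ : Fin K → Ω → ℕ∞) (X : Fin K → ℕ → Ω → E) :
    ℕ → MeasurableSpace Ω × (Ω → Finset (Fin K))
  | 0 => (⊥, fun _ => Finset.univ)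
  | t + 1 =>
    (observe (procedure P α τ X t).1 (procedure P α τ X t).2 (fun k => X k (t + 1)),
      fun ω => oneStepUpdate α ((procedure P α τ X t).2 ω) (fun k =>
        postProb P τ
          (observe (procedure P α τ X t).1 (procedure P α τ X t).2 (fun k => X k (t + 1)))
          k (t + 1) ω))

/-- The information `F_t` of the proposed procedure at time `t`. -/
@[reducible]
noncomputable def info {Ω E : Type*} [MeasurableSpace Ω] [MeasurableSpace E]
    (P : Measure Ω) (α : ℝ) {K : ℕ} (τ : Fin K → Ω → ℕ∞) (X : Fin K → ℕ → Ω → E) (t : ℕ) :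
    MeasurableSpace Ω :=
  (procedure P α τ X t).1

/-- The set `S_{t+1}` of the streams that are active at time `t + 1` in the proposed procedure. -/
noncomputable def activeNext {Ω E : Type*} [MeasurableSpace Ω] [MeasurableSpace E]
    (P : Measure Ω) (α : ℝ) {K : ℕ} (τ : Fin K → Ω → ℕ∞) (X : Fin K → ℕ → Ω → E) (t : ℕ) :
    Ω → Finset (Fin K) :=
  (procedure P α τ X t).2

open Classical in
/-- The threshold `max {W_{k,t} : k ∈ S_{t+1}}` used by the proposed procedure at time `t`, where
`W_{k,t} = P(τ_k < t | F_t)`. It is given the value `0` when `S_{t+1}` is empty. -/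
noncomputable def threshold {Ω E : Type*} [MeasurableSpace Ω] [MeasurableSpace E]
    (P : Measure Ω) (α : ℝ) {K : ℕ} (τ : Fin K → Ω → ℕ∞) (X : Fin K → ℕ → Ω → E) (t : ℕ)
    (ω : Ω) : ℝ :=
  if h : (activeNext P α τ X t ω).Nonempty then
    (activeNext P α τ X t ω).sup' h (fun k => postProb P τ (info P α τ X t) k t ω)
  else 0

open Classical in
/-- The false non-discovery proportion `FNP_{t+1}`: the proportion, among the streams active at
time `t + 1`, of those that have changed strictly before time `t`. -/
noncomputable def fnpNext {Ω : Type*} {K : ℕ} (τ : Fin K → Ω → ℕ∞) (S : Ω → Finset (Fin K))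
    (t : ℕ) (ω : Ω) : ℝ :=
  (((S ω).filter fun k => τ k ω < (t : ℕ∞)).card : ℝ) / (max (S ω).card 1 : ℕ)

/-- The local false non-discovery rate `LFNR_{t+1} = E(FNP_{t+1} | F_t)` of the proposed
procedure. -/
noncomputable def lfnrNext {Ω E : Type*} [MeasurableSpace Ω] [MeasurableSpace E]
    (P : Measure Ω) (α : ℝ) {K : ℕ} (τ : Fin K → Ω → ℕ∞) (X : Fin K → ℕ → Ω → E) (t : ℕ) :
    Ω → ℝ :=
  condExp (info P α τ X t) P (fnpNext τ (activeNext P α τ X t) t)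

/-! ### The limiting thresholds -/

/-- The process `V` along the observations `x 1, x 2, …` of a single stream. -/
noncomputable def vSeq {E : Type*} (p q : E → ℝ) (θ : ℝ) (x : ℕ → E) : ℕ → ℝ
  | 0 => 0
  | t + 1 =>
    (q (x (t + 1)) / p (x (t + 1))) /
      ((1 - θ) * (1 - vSeq p q θ x t) / (θ + (1 - θ) * vSeq p q θ x t)
        + q (x (t + 1)) / p (x (t + 1)))

/-- The conditional expectation `E(Y | A)` given an event `A`. -/
noncomputable def expectGiven {Ω : Type*} [MeasurableSpace Ω] (P : Measure Ω)
    (Y : Ω → ℝ) (A : Set Ω) : ℝ :=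
  ∫ ω, Y ω ∂(cond P A)

/-- The limiting thresholds of a process `V`: `λ_0 = 1` and, for `t ≥ 1`,
`λ_t = sup {l ∈ [0, 1] : E(V_t | V_t ≤ l, V_s ≤ λ_s, 0 ≤ s ≤ t - 1) ≤ α}`. -/
noncomputable def limitThreshold {Ω : Type*} [MeasurableSpace Ω] (P : Measure Ω) (α : ℝ)
    (V : ℕ → Ω → ℝ) : ℕ → ℝ
  | 0 => 1
  | t + 1 =>
    sSup {l : ℝ | l ∈ Set.Icc (0 : ℝ) 1 ∧
      expectGiven P (V (t + 1))
        {ω | V (t + 1) ω ≤ l ∧ ∀ s : Fin (t + 1), V s ω ≤ limitThreshold P α V s} ≤ α}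
termination_by t => t
decreasing_by exact s.isLt

end ChangePoint

open ChangePoint

namespace ChangePoint

/-! ### The one-step update rule -/

section OneStepUpdate

variable {K : ℕ} (S : Finset (Fin K)) (w : Fin K → ℝ)

/-! The proof turns the procedure into a deterministic rule applied to i.i.d. numbers, and then
follows that rule through the law of large numbers.

Bayes: for a single stream, `V_t` is the conditional probability of a change before `t` given the
stream's first `t` observations (`lintegral_one_sub_posterior_postLaw`, `lintegral_postLaw`). The
streams are independent, so the same holds given the observations of all streams. The information of
the procedure is coarser than that, but it still determines `V_t` of every stream observed at time
`t`; hence for those streams the posterior probability is the stream's own `V_t` almost surely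
(`IsStreamModel.postProb_eq`).

Crossing: let `A` be the event that `V` has stayed below the limiting thresholds so far, and let `N
l`, `M l` be the mass of, and the integral of `V` over, the part of `A` where the next value of `V`
is at most `l`. The density assumption makes this next value diffuse with full support on the unit
interval, so `N` is continuous and strictly increasing and `M / N` is strictly increasing. The
limiting threshold is thus a genuine crossing of `α` by `M / N`, or `1` if `α` is not exceeded
(`IsPartialMean.isCrossing`). The recursion `E(V_{t+1}; B) = θ P(B) + (1 - θ) E(V_t; B)` for `B` in
the past, followed by cutting at `α`, gives the conditional mean `min (1 - (1 - θ)^t) α`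
(`obsLaw_survivors`).

Propagation: by induction on `t`, the active set and the set of streams with `V_s ≤ λ_s` for all `s
≤ t` differ in `o(K)` indices. Below the crossing the empirical average is eventually under `α`, so
every stream there is kept; above it the average is eventually over `α`, so nothing higher is kept.
Continuity of `N` makes the gap between two such levels negligible
(`EmpiricalLimit.tendsto_discrepancy_oneStepUpdate`). All three limits follow; rational levels
suffice, so one almost sure event serves all of them. -/

theorem rank_lt_rank {j k : Fin K} (hj : j ∈ S) (h : w j < w k ∨ (w j = w k ∧ j < k)) :
    rank S w j < rank S w k := by
  refine Finset.card_lt_card ⟨fun i hi => ?_, fun hsub => ?_⟩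
  · simp only [Finset.mem_filter] at hi ⊢
    refine ⟨hi.1, ?_⟩
    rcases hi.2 with h1 | h1 <;> rcases h with h2 | h2
    · exact Or.inl (h1.trans h2)
    · exact Or.inl (h2.1 ▸ h1)
    · exact Or.inl (h1.1 ▸ h2)
    · exact Or.inr ⟨h1.1.trans h2.1, h1.2.trans h2.2⟩
  · have := hsub (Finset.mem_filter.2 ⟨hj, h⟩)
    simp at this

theorem rank_injOn : Set.InjOn (rank S w) S := by
  intro j hj k hk h
  by_contra hne
  rcases lt_trichotomy (w j) (w k) with h1 | h1 | h1
  · exact (rank_lt_rank S w hj (Or.inl h1)).ne h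
  · rcases lt_or_gt_of_ne hne with h2 | h2
    · exact (rank_lt_rank S w hj (Or.inr ⟨h1, h2⟩)).ne h
    · exact (rank_lt_rank S w hk (Or.inr ⟨h1.symm, h2⟩)).ne' h
  · exact (rank_lt_rank S w hk (Or.inl h1)).ne' h

theorem rank_lt_card {k : Fin K} (hk : k ∈ S) : rank S w k < S.card :=
  Finset.card_lt_card ⟨Finset.filter_subset _ _, fun h => by simpa using h hk⟩

/-- Ranks are distinct and smaller than `S.card`, so every value below `S.card` is taken. This is
what gives `smallest S w n` exactly `n` elements. -/
theorem image_rank : S.image (rank S w) = Finset.range S.card := by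
  refine Finset.eq_of_subset_of_card_le (fun n hn => ?_) ?_
  · obtain ⟨k, hk, rfl⟩ := Finset.mem_image.1 hn
    exact Finset.mem_range.2 (rank_lt_card S w hk)
  · rw [Finset.card_image_of_injOn (rank_injOn S w), Finset.card_range]

theorem smallest_subset (n : ℕ) : smallest S w n ⊆ S := Finset.filter_subset _ _

theorem card_smallest {n : ℕ} (hn : n ≤ S.card) : (smallest S w n).card = n := by
  have h : (smallest S w n).image (rank S w) = Finset.range n := by
    ext i
    simp only [smallest, Finset.mem_image, Finset.mem_filter, Finset.mem_range]
    constructor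
    · rintro ⟨k, hk, rfl⟩
      exact hk.2
    · intro hi
      have : i ∈ S.image (rank S w) := by
        rw [image_rank]
        exact Finset.mem_range.2 (hi.trans_le hn)
      obtain ⟨k, hk, rfl⟩ := Finset.mem_image.1 this
      exact ⟨k, ⟨hk, hi⟩, rfl⟩
  have hc := Finset.card_image_of_injOn
    ((rank_injOn S w).mono (Finset.coe_subset.2 (smallest_subset S w n)))
  rw [h, Finset.card_range] at hc
  exact hc.symm

theorem smallest_mono {m n : ℕ} (h : m ≤ n) : smallest S w m ⊆ smallest S w n :=
  fun _ hk => Finset.mem_filter.2 ⟨(Finset.mem_filter.1 hk).1, (Finset.mem_filter.1 hk).2.trans_le h⟩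

/-- Everything that precedes an element of a sublevel set lies in that set, so sublevel sets are
initial segments of the sorted order and can be compared with the set kept by the update. -/
theorem smallest_card_filter_le (l : ℝ) :
    smallest S w (S.filter fun k => w k ≤ l).card = S.filter fun k => w k ≤ l := by
  symm
  refine Finset.eq_of_subset_of_card_le (fun k hk => ?_) ?_
  · refine Finset.mem_filter.2 ⟨(Finset.mem_filter.1 hk).1, ?_⟩
    refine Finset.card_lt_card ⟨fun j hj => ?_, fun h => by simpa using h hk⟩
    simp only [Finset.mem_filter] at hj hk ⊢
    exact ⟨hj.1, (by rcases hj.2 with h | h; exacts [h.le, h.1.le] : w j ≤ w k).trans hk.2⟩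
  · exact (card_smallest S w (Finset.card_le_card (Finset.filter_subset _ _))).le

theorem cumulativeAverage_le_iff {α : ℝ} (hα : 0 ≤ α) (n : ℕ) (hn : n ≤ S.card) :
    cumulativeAverage S w n ≤ α ↔ ∑ k ∈ smallest S w n, w k ≤ α * n := by
  rcases Nat.eq_zero_or_pos n with rfl | h
  · simp [cumulativeAverage, smallest, hα]
  · rw [cumulativeAverage, div_le_iff₀ (by exact_mod_cast h)]

theorem oneStepUpdate_subset (α : ℝ) : oneStepUpdate α S w ⊆ S := smallest_subset S w _

theorem mem_oneStepUpdate_of_lt {α : ℝ} {j k : Fin K} (hk : k ∈ oneStepUpdate α S w)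
    (hj : j ∈ S) (h : w j < w k) : j ∈ oneStepUpdate α S w :=
  Finset.mem_filter.2 ⟨hj, (rank_lt_rank S w hj (Or.inl h)).trans (Finset.mem_filter.1 hk).2⟩

theorem sum_oneStepUpdate_le {α : ℝ} (hα : 0 ≤ α) :
    ∑ k ∈ oneStepUpdate α S w, w k ≤ α * (oneStepUpdate α S w).card := by
  have h := Nat.findGreatest_spec (P := fun n => cumulativeAverage S w n ≤ α)
    (Nat.zero_le S.card) (by simp [cumulativeAverage, hα])
  rw [cumulativeAverage_le_iff S w hα _ (Nat.findGreatest_le _)] at h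
  unfold oneStepUpdate
  rwa [card_smallest S w (Nat.findGreatest_le _)]

theorem filter_le_subset_oneStepUpdate {α : ℝ} (hα : 0 ≤ α) (l : ℝ)
    (h : ∑ k ∈ S.filter (fun k => w k ≤ l), w k ≤ α * (S.filter fun k => w k ≤ l).card) :
    (S.filter fun k => w k ≤ l) ⊆ oneStepUpdate α S w := by
  rw [← smallest_card_filter_le S w l]
  refine smallest_mono S w (Nat.le_findGreatest (Finset.card_le_card (Finset.filter_subset _ _)) ?_)
  rw [cumulativeAverage_le_iff S w hα _ (Finset.card_le_card (Finset.filter_subset _ _)),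
    smallest_card_filter_le]
  exact h

/-- If a value above `l` were kept, the whole sublevel set `D` would be kept too. The average over
`D` exceeds `α` while its values are at most `l`, so `α < l`, and each further kept value is above
`α`. The average over the kept set would then exceed `α`. -/
theorem oneStepUpdate_subset_filter_le {α : ℝ} (hα : 0 ≤ α) (l : ℝ)
    (h : α * (S.filter fun k => w k ≤ l).card < ∑ k ∈ S.filter (fun k => w k ≤ l), w k) :
    oneStepUpdate α S w ⊆ S.filter fun k => w k ≤ l := by
  set D := S.filter fun k => w k ≤ l with hD
  set U := oneStepUpdate α S w with hU
  by_contra hsub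
  obtain ⟨k, hkU, hkD⟩ := Finset.not_subset.1 hsub
  have hkS : k ∈ S := oneStepUpdate_subset S w α hkU
  have hkl : l < w k := by
    by_contra hc
    exact hkD (Finset.mem_filter.2 ⟨hkS, not_lt.1 hc⟩)
  have hDU : D ⊆ U := fun j hj => mem_oneStepUpdate_of_lt S w hkU (Finset.mem_filter.1 hj).1
    ((Finset.mem_filter.1 hj).2.trans_lt hkl)
  have hDl : ∑ k ∈ D, w k ≤ D.card • l :=
    Finset.sum_le_card_nsmul _ _ _ fun j hj => (Finset.mem_filter.1 hj).2
  have hαl : α < l := by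
    rw [nsmul_eq_mul] at hDl
    have : (D.card : ℝ) * (l - α) > 0 := by linarith
    nlinarith [pos_of_mul_pos_right this (Nat.cast_nonneg _)]
  have h1 : (U \ D).card • α ≤ ∑ k ∈ U \ D, w k := by
    refine Finset.card_nsmul_le_sum _ _ _ fun j hj => ?_
    have hj' := Finset.mem_sdiff.1 hj
    by_contra hc
    exact hj'.2 (Finset.mem_filter.2 ⟨oneStepUpdate_subset S w α hj'.1, by linarith⟩)
  have h2 := Finset.sum_sdiff hDU (f := w)
  have h3 : ((U \ D).card : ℝ) + D.card = U.card := by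
    exact_mod_cast Finset.card_sdiff_add_card_eq_card hDU
  have h4 := sum_oneStepUpdate_le S w hα
  rw [← hU] at h4
  rw [nsmul_eq_mul] at h1
  nlinarith

theorem measurable_rank (k : Fin K) : Measurable fun w : Fin K → ℝ => rank S w k := by
  classical
  have : (fun w : Fin K → ℝ => rank S w k) = fun w => ∑ j ∈ S,
      if w ∈ {w : Fin K → ℝ | w j < w k ∨ (w j = w k ∧ j < k)} then 1 else 0 := by
    funext w
    rw [rank, Finset.card_filter]
    exact Finset.sum_congr rfl fun j _ => by congr
  rw [this]
  refine Finset.measurable_sum _ fun j _ => Measurable.ite ?_ measurable_const measurable_const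
  refine (measurableSet_lt (measurable_pi_apply j) (measurable_pi_apply k)).union
    ((measurableSet_eq_fun (measurable_pi_apply j) (measurable_pi_apply k)).inter ?_)
  exact MeasurableSet.const _

theorem measurable_cumulativeAverage (n : ℕ) :
    Measurable fun w : Fin K → ℝ => cumulativeAverage S w n := by
  classical
  unfold cumulativeAverage
  refine Measurable.div_const ?_ _
  have : (fun w : Fin K → ℝ => ∑ k ∈ smallest S w n, w k) = fun w => ∑ k ∈ S,
      if w ∈ {w : Fin K → ℝ | rank S w k < n} then w k else 0 := by
    funext w
    simp [smallest, Finset.sum_filter]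
  rw [this]
  refine Finset.measurable_sum _ fun k _ =>
    Measurable.ite ?_ (measurable_pi_apply k) measurable_const
  exact measurableSet_lt (measurable_rank S k) measurable_const

theorem measurable_oneStepUpdate_right (α : ℝ) :
    @Measurable _ _ _ ⊤ fun w : Fin K → ℝ => oneStepUpdate α S w := by
  classical
  have hg : Measurable fun w : Fin K → ℝ =>
      Nat.findGreatest (fun n => cumulativeAverage S w n ≤ α) S.card :=
    measurable_findGreatest fun n _ =>
      measurableSet_le (measurable_cumulativeAverage S n) measurable_const
  let : MeasurableSpace (Finset (Fin K)) := ⊤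
  refine measurable_to_countable' fun U => ?_
  have : (fun w : Fin K → ℝ => oneStepUpdate α S w) ⁻¹' {U} = ⋂ k : Fin K,
      {w | (k ∈ S ∧ rank S w k <
        Nat.findGreatest (fun n => cumulativeAverage S w n ≤ α) S.card) ↔ k ∈ U} := by
    ext w
    simp [oneStepUpdate, smallest, Finset.ext_iff]
  rw [this]
  refine MeasurableSet.iInter fun k => ?_
  refine MeasurableSet.iff ?_ (MeasurableSet.const _)
  exact (MeasurableSet.const _).inter (measurableSet_lt (measurable_rank S k) hg)

end OneStepUpdate

theorem measurable_oneStepUpdate {Ω : Type*} {m : MeasurableSpace Ω} {K : ℕ} (α : ℝ)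
    {S : Ω → Finset (Fin K)} {w : Fin K → Ω → ℝ} (hS : @Measurable _ _ m ⊤ S)
    (hw : ∀ k, Measurable (w k)) :
    @Measurable _ _ m ⊤ fun ω => oneStepUpdate α (S ω) fun k => w k ω := by
  let : MeasurableSpace (Finset (Fin K)) := ⊤
  refine measurable_to_countable' fun U => ?_
  -- Only finitely many values of `S` occur, so the update may be studied with `S` frozen.
  have : (fun ω => oneStepUpdate α (S ω) fun k => w k ω) ⁻¹' {U} = ⋃ T : Finset (Fin K),
      S ⁻¹' {T} ∩ (fun ω => oneStepUpdate α T fun k => w k ω) ⁻¹' {U} := by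
    ext ω
    simp
  rw [this]
  refine MeasurableSet.iUnion fun T => (hS (measurableSet_singleton T)).inter ?_
  exact ((measurable_oneStepUpdate_right T α).comp (measurable_pi_lambda _ hw))
    (measurableSet_singleton U)

/-! ### Propagation of empirical limits through the one-step update -/

section EmpiricalLimit

open Classical in
/-- The number of indices at which the finite set `S` and the set `A` differ. -/
noncomputable def discrepancy {K : ℕ} (S : Finset (Fin K)) (A : Set ℕ) : ℕ :=
  (Finset.univ.filter fun k : Fin K => ¬(k ∈ S ↔ (k : ℕ) ∈ A)).card

theorem abs_sum_sub_sum_indicator_le {K : ℕ} (S : Finset (Fin K)) (A : Set ℕ) {g : ℕ → ℝ}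
    (hg : ∀ k, g k ∈ Set.Icc (0 : ℝ) 1) :
    |∑ k ∈ S, g k - ∑ k ∈ Finset.range K, A.indicator g k| ≤ discrepancy S A := by
  classical
  rw [Finset.sum_range, show (∑ k ∈ S, g k) = ∑ k : Fin K, if k ∈ S then g k else 0 by simp,
    ← Finset.sum_sub_distrib,
    discrepancy, Finset.card_filter]
  push_cast
  refine (Finset.abs_sum_le_sum_abs _ _).trans (Finset.sum_le_sum fun k _ => ?_)
  have := hg k
  have h0 := this.1
  have h1 := this.2
  by_cases h2 : k ∈ S <;> by_cases h3 : (k : ℕ) ∈ A <;> simp [h2, h3, abs_of_nonneg h0, h1]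

/-- An index on which the two sets disagree changes the sum by at most `1`, so `o(K)` disagreements
do not affect averages of `[0, 1]`-valued quantities. -/
theorem tendsto_sum_div_of_discrepancy {S : ∀ K, Finset (Fin K)} {A : Set ℕ}
    (hd : Tendsto (fun K => (discrepancy (S K) A : ℝ) / K) atTop (𝓝 0)) {g : ℕ → ℝ}
    (hg : ∀ k, g k ∈ Set.Icc (0 : ℝ) 1) {c : ℝ}
    (hc : Tendsto (fun K : ℕ => (∑ k ∈ Finset.range K, A.indicator g k) / K) atTop (𝓝 c)) :
    Tendsto (fun K : ℕ => (∑ k ∈ S K, g k) / K) atTop (𝓝 c) := by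
  have h : Tendsto (fun K : ℕ => (∑ k ∈ S K, g k) / K -
      (∑ k ∈ Finset.range K, A.indicator g k) / K) atTop (𝓝 0) := by
    refine squeeze_zero_norm (fun K => ?_) hd
    rw [← sub_div, norm_div, Real.norm_eq_abs, Real.norm_natCast]
    exact div_le_div_of_nonneg_right (abs_sum_sub_sum_indicator_le _ _ hg) (Nat.cast_nonneg _)
  simpa using h.add hc

variable {α : ℝ} {v : ℕ → ℝ} {A : Set ℕ} {S : ∀ K, Finset (Fin K)} {w : ∀ K, Fin K → ℝ}
  {N M : ℝ → ℝ} {lam : ℝ}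

/-- Empirical distribution hypotheses: along the streams in `A`, the values `v` have the limiting
distribution function `N` and the limiting partial means `M` at rational levels, and the sets
`S K` differ from `A` at a negligible proportion of the indices. -/
structure EmpiricalLimit (v : ℕ → ℝ) (A : Set ℕ) (S : ∀ K, Finset (Fin K)) (w : ∀ K, Fin K → ℝ)
    (N M : ℝ → ℝ) : Prop where
  mem_Icc : ∀ k, v k ∈ Set.Icc (0 : ℝ) 1
  eq_of_mem : ∀ K, ∀ k ∈ S K, w K k = v k
  tendsto_discrepancy : Tendsto (fun K => (discrepancy (S K) A : ℝ) / K) atTop (𝓝 0)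
  tendsto_count : ∀ r : ℚ, Tendsto (fun K : ℕ => (∑ k ∈ Finset.range K,
    A.indicator (fun k => {k | v k ≤ r}.indicator (fun _ => (1 : ℝ)) k) k) / K) atTop (𝓝 (N r))
  tendsto_sum : ∀ r : ℚ, Tendsto (fun K : ℕ => (∑ k ∈ Finset.range K,
    A.indicator (fun k => {k | v k ≤ r}.indicator v k) k) / K) atTop (𝓝 (M r))

theorem EmpiricalLimit.tendsto_card_filter (h : EmpiricalLimit v A S w N M) (r : ℚ) :
    Tendsto (fun K : ℕ => (((S K).filter fun k => w K k ≤ r).card : ℝ) / K) atTop (𝓝 (N r)) := by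
  refine (tendsto_sum_div_of_discrepancy h.tendsto_discrepancy (fun k => ?_)
    (h.tendsto_count r)).congr fun K => ?_
  · by_cases hk : v k ≤ r <;> simp [hk]
  · rw [Finset.card_filter]
    push_cast
    congr 1
    refine Finset.sum_congr rfl fun k hk => ?_
    simp [Set.indicator_apply, h.eq_of_mem K k hk]

theorem EmpiricalLimit.tendsto_sum_filter (h : EmpiricalLimit v A S w N M) (r : ℚ) :
    Tendsto (fun K : ℕ => (∑ k ∈ (S K).filter fun k => w K k ≤ r, w K k) / K)
      atTop (𝓝 (M r)) := by
  refine (tendsto_sum_div_of_discrepancy h.tendsto_discrepancy (fun k => ?_)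
    (h.tendsto_sum r)).congr fun K => ?_
  · by_cases hk : v k ≤ r
    · simpa [hk] using h.mem_Icc k
    · simp [hk]
  · rw [Finset.sum_filter]
    congr 1
    refine Finset.sum_congr rfl fun k hk => ?_
    simp [Set.indicator_apply, h.eq_of_mem K k hk]

theorem eventually_lt_of_tendsto_div {a b : ℕ → ℝ} {x y : ℝ}
    (ha : Tendsto (fun K : ℕ => a K / K) atTop (𝓝 x))
    (hb : Tendsto (fun K : ℕ => b K / K) atTop (𝓝 y)) (hxy : x < y) :
    ∀ᶠ K in atTop, a K < b K := by
  filter_upwards [ha.eventually_lt hb hxy, eventually_gt_atTop 0] with K h hK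
  exact (div_lt_div_iff_of_pos_right (Nat.cast_pos.2 hK)).1 h

theorem EmpiricalLimit.eventually_filter_subset (h : EmpiricalLimit v A S w N M) (hα : 0 < α)
    {r : ℚ} (hr : M r < α * N r) :
    ∀ᶠ K in atTop, ((S K).filter fun k => w K k ≤ r) ⊆ oneStepUpdate α (S K) (w K) := by
  have h2 : Tendsto (fun K : ℕ => (α * ((S K).filter fun k => w K k ≤ r).card) / K) atTop
      (𝓝 (α * N r)) := by
    simpa only [mul_div_assoc] using (h.tendsto_card_filter r).const_mul α
  filter_upwards [eventually_lt_of_tendsto_div (h.tendsto_sum_filter r) h2 hr] with K hK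
  exact filter_le_subset_oneStepUpdate _ _ hα.le _ hK.le

theorem EmpiricalLimit.eventually_subset_filter (h : EmpiricalLimit v A S w N M) (hα : 0 < α)
    {r : ℚ} (hr : 1 < r ∨ α * N r < M r) :
    ∀ᶠ K in atTop, oneStepUpdate α (S K) (w K) ⊆ (S K).filter fun k => w K k ≤ r := by
  -- If the crossing is at `1`, no level above it has an average over `α`; there the bound `v ≤ 1`
  -- does the work instead.
  rcases hr with hr | hr
  · refine Eventually.of_forall fun K k hk => ?_
    have hkS := oneStepUpdate_subset _ _ _ hk
    refine Finset.mem_filter.2 ⟨hkS, ?_⟩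
    rw [h.eq_of_mem K k hkS]
    exact (h.mem_Icc k).2.trans (by exact_mod_cast hr.le)
  · have h2 : Tendsto (fun K : ℕ => (α * ((S K).filter fun k => w K k ≤ r).card) / K) atTop
        (𝓝 (α * N r)) := by
      simpa only [mul_div_assoc] using (h.tendsto_card_filter r).const_mul α
    filter_upwards [eventually_lt_of_tendsto_div h2 (h.tendsto_sum_filter r) hr] with K hK
    exact oneStepUpdate_subset_filter_le _ _ hα.le _ hK

/-- `lam` is the level at which the limiting average `M / N` crosses `α`. -/
structure IsCrossing (α : ℝ) (N M : ℝ → ℝ) (lam : ℝ) : Prop where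
  pos : 0 < lam
  le_one : lam ≤ 1
  strictMonoOn : StrictMonoOn N (Set.Icc 0 1)
  continuousAt : ContinuousAt N lam
  lt_of_lt : ∀ l, 0 < l → l < lam → M l < α * N l
  lt_of_gt : ∀ l, lam < l → l ≤ 1 → α * N l < M l

theorem EmpiricalLimit.eventually_exists_lt (h : EmpiricalLimit v A S w N M) (hα : 0 < α)
    (hc : IsCrossing α N M lam) {l : ℝ} (hl : l < lam) :
    ∀ᶠ K in atTop, ∃ k ∈ oneStepUpdate α (S K) (w K), l < w K k := by
  -- Two levels below the crossing: everything up to `r'` is kept, and strict monotonicity of `N`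
  -- puts a stream between `r` and `r'`.
  obtain ⟨r, hr1, hr2⟩ := exists_rat_btwn (max_lt hl hc.pos)
  obtain ⟨r', hr'1, hr'2⟩ := exists_rat_btwn hr2
  have hr0 : (0 : ℝ) < r := (le_max_right _ _).trans_lt hr1
  have hN : N r < N r' := hc.strictMonoOn ⟨hr0.le, hr2.le.trans hc.le_one⟩
    ⟨(hr0.trans hr'1).le, hr'2.le.trans hc.le_one⟩ hr'1
  filter_upwards [h.eventually_filter_subset hα (hc.lt_of_lt r' (hr0.trans hr'1) hr'2),
    eventually_lt_of_tendsto_div (h.tendsto_card_filter r) (h.tendsto_card_filter r') hN]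
    with K hK1 hK2
  obtain ⟨k, hk, hk'⟩ := Finset.exists_mem_notMem_of_card_lt_card (by exact_mod_cast hK2)
  refine ⟨k, hK1 hk, (le_max_left _ _).trans_lt (hr1.trans ?_)⟩
  by_contra hcon
  exact hk' (Finset.mem_filter.2 ⟨(Finset.mem_filter.1 hk).1, not_lt.1 hcon⟩)

theorem EmpiricalLimit.eventually_forall_le (h : EmpiricalLimit v A S w N M) (hα : 0 < α)
    (hc : IsCrossing α N M lam) {l : ℝ} (hl : lam < l) :
    ∀ᶠ K in atTop, ∀ k ∈ oneStepUpdate α (S K) (w K), w K k < l := by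
  obtain ⟨r, hr1, hr2⟩ := exists_rat_btwn hl
  have : 1 < r ∨ α * N r < M r := by
    by_cases h1 : (1 : ℝ) < r
    · exact Or.inl (by exact_mod_cast h1)
    · exact Or.inr (hc.lt_of_gt r hr1 (not_lt.1 h1))
  filter_upwards [h.eventually_subset_filter hα this] with K hK k hk
  exact (Finset.mem_filter.1 (hK hk)).2.trans_lt hr2

/-- A new disagreement comes either from an old one between `S` and `A`, or from an index of `A`
with value in `(l, l']`, where the sandwich says nothing. The proof checks all truth assignments. -/
theorem discrepancy_le_add {K : ℕ} {S U : Finset (Fin K)} {A : Set ℕ} {v : ℕ → ℝ} {w : Fin K → ℝ}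
    (hw : ∀ k ∈ S, w k = v k) {l l' lam : ℝ} (hl : l < lam) (hl' : lam < l') (hUS : U ⊆ S)
    (h1 : (S.filter fun k => w k ≤ l) ⊆ U) (h2 : U ⊆ S.filter fun k => w k ≤ l') :
    (discrepancy U (A ∩ {k | v k ≤ lam}) : ℝ) ≤ discrepancy S A +
      (∑ k ∈ Finset.range K,
        A.indicator (fun k => {k | v k ≤ l'}.indicator (fun _ => (1 : ℝ)) k) k -
      ∑ k ∈ Finset.range K,
        A.indicator (fun k => {k | v k ≤ l}.indicator (fun _ => (1 : ℝ)) k) k) := by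
  classical
  rw [discrepancy, discrepancy, Finset.card_filter, Finset.card_filter, Finset.sum_range,
    Finset.sum_range, ← Finset.sum_sub_distrib]
  push_cast
  rw [← Finset.sum_add_distrib]
  refine Finset.sum_le_sum fun k _ => ?_
  have e1 : k ∈ S → v k ≤ l → k ∈ U := fun hk hv =>
    h1 (Finset.mem_filter.2 ⟨hk, by rwa [hw k hk]⟩)
  have e2 : k ∈ U → k ∈ S ∧ v k ≤ l' := fun hk =>
    ⟨hUS hk, by rw [← hw k (hUS hk)]; exact (Finset.mem_filter.1 (h2 hk)).2⟩
  simp only [Set.indicator_apply, Set.mem_inter_iff, Set.mem_ofPred_eq]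
  by_cases a : k ∈ S <;> by_cases b : (k : ℕ) ∈ A <;> by_cases c : k ∈ U <;>
    by_cases d : v k ≤ lam <;> by_cases e : v k ≤ l <;> by_cases f : v k ≤ l' <;>
    simp only [a, b, c, d, e, f, if_true, if_false, and_true, and_false, not_true,
      not_false_eq_true, iff_true, iff_false, iff_self] <;>
    first
    | norm_num; done
    | (exfalso; first | linarith | exact c (e1 a e) | exact a (e2 c).1 | exact f (e2 c).2)

theorem EmpiricalLimit.tendsto_discrepancy_oneStepUpdate (h : EmpiricalLimit v A S w N M)
    (hα : 0 < α) (hc : IsCrossing α N M lam) :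
    Tendsto (fun K => (discrepancy (oneStepUpdate α (S K) (w K)) (A ∩ {k | v k ≤ lam}) : ℝ) / K)
      atTop (𝓝 0) := by
  refine tendsto_order.2 ⟨fun a ha => Eventually.of_forall fun K => ha.trans_le (by positivity),
    fun ε hε => ?_⟩
  obtain ⟨δ, hδ, hδN⟩ := Metric.continuousAt_iff.1 hc.continuousAt (ε / 2) (by positivity)
  obtain ⟨r, hr1, hr2⟩ := exists_rat_btwn (max_lt (sub_lt_self lam hδ) hc.pos)
  obtain ⟨r', hr'1, hr'2⟩ := exists_rat_btwn (lt_add_of_pos_right lam hδ)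
  have hr0 : (0 : ℝ) < r := (le_max_right _ _).trans_lt hr1
  have hrδ : lam - δ < r := (le_max_left _ _).trans_lt hr1
  -- Both levels lie within `δ` of the crossing, so the mass between them is below `ε`.
  have b1 := hδN (x := (r : ℝ)) (by rw [Real.dist_eq, abs_lt]; constructor <;> linarith)
  have b2 := hδN (x := (r' : ℝ)) (by rw [Real.dist_eq, abs_lt]; constructor <;> linarith)
  rw [Real.dist_eq, abs_lt] at b1 b2
  have hr'c : 1 < r' ∨ α * N r' < M r' := by
    by_cases h1 : (1 : ℝ) < r'
    · exact Or.inl (by exact_mod_cast h1)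
    · exact Or.inr (hc.lt_of_gt r' hr'1 (not_lt.1 h1))
  have hlim := h.tendsto_discrepancy.add ((h.tendsto_count r').sub (h.tendsto_count r))
  filter_upwards [h.eventually_filter_subset hα (hc.lt_of_lt r hr0 hr2),
    h.eventually_subset_filter hα hr'c,
    hlim.eventually_lt_const (show 0 + (N r' - N r) < ε by linarith)] with K h1 h2 h3
  refine lt_of_le_of_lt ?_ h3
  rw [← sub_div, ← add_div]
  exact div_le_div_of_nonneg_right (discrepancy_le_add (h.eq_of_mem K) hr2 hr'1
    (oneStepUpdate_subset _ _ _) h1 h2) (Nat.cast_nonneg _)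

open Classical in
theorem EmpiricalLimit.tendsto_sup (h : EmpiricalLimit v A S w N M) (hα : 0 < α)
    (hc : IsCrossing α N M lam) :
    Tendsto (fun K => if hU : (oneStepUpdate α (S K) (w K)).Nonempty then
      (oneStepUpdate α (S K) (w K)).sup' hU (w K) else 0) atTop (𝓝 lam) := by
  refine tendsto_order.2 ⟨fun l hl => ?_, fun l hl => ?_⟩
  · filter_upwards [h.eventually_exists_lt hα hc hl] with K ⟨k, hk, hlk⟩
    rw [dif_pos ⟨k, hk⟩]
    exact hlk.trans_le (Finset.le_sup' _ hk)
  · filter_upwards [h.eventually_forall_le hα hc hl] with K hK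
    split_ifs with hU
    · exact (Finset.sup'_lt_iff hU).2 hK
    -- The default value `0` for an empty kept set respects the upper bound because the crossing is
    -- positive; the lower bound above already produces a kept stream.
    · exact hc.pos.trans hl

end EmpiricalLimit

/-! ### The law of a single stream and independence of the streams -/

section StreamLaw

variable {E : Type*} [MeasurableSpace E] (ν₀ ν₁ : Measure E) [IsProbabilityMeasure ν₀]
  [IsProbabilityMeasure ν₁]

instance isProbabilityMeasure_ite (c : Prop) [Decidable c] :
    IsProbabilityMeasure (if c then ν₀ else ν₁) := by
  split_ifs <;> infer_instance

/-- The law of the observations of a stream (indexed from `0`) with change point `m`. -/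
noncomputable def streamLaw (m : ℕ) : Measure (ℕ → E) :=
  Measure.infinitePi fun i => if i + 1 ≤ m then ν₀ else ν₁

instance (m : ℕ) : IsProbabilityMeasure (streamLaw ν₀ ν₁ m) := by
  unfold streamLaw
  infer_instance

/-- The geometric weight of the change point `m`. -/
noncomputable def geomWeight (θ : ℝ) (m : ℕ) : ENNReal := ENNReal.ofReal (θ * (1 - θ) ^ m)

theorem tsum_geomWeight {θ : ℝ} (h0 : 0 < θ) (h1 : θ < 1) : ∑' m, geomWeight θ m = 1 := by
  have hs : HasSum (fun m : ℕ => θ * (1 - θ) ^ m) 1 := by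
    have := (hasSum_geometric_of_lt_one (by linarith : 0 ≤ 1 - θ) (by linarith)).mul_left θ
    simpa [h0.ne'] using this
  unfold geomWeight
  rw [← ENNReal.ofReal_tsum_of_nonneg (fun m => mul_nonneg h0.le (pow_nonneg (by linarith) _))
    hs.summable, hs.tsum_eq, ENNReal.ofReal_one]

theorem geomWeight_pos {θ : ℝ} (h0 : 0 < θ) (h1 : θ < 1) (m : ℕ) : 0 < geomWeight θ m :=
  ENNReal.ofReal_pos.2 (mul_pos h0 (pow_pos (by linarith) _))

theorem geomWeight_ne_top (θ : ℝ) (m : ℕ) : geomWeight θ m ≠ ⊤ := ENNReal.ofReal_ne_top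

/-- The joint law of the change point and the observations of a stream. -/
noncomputable def jointLaw (θ : ℝ) : Measure (ℕ × (ℕ → E)) :=
  Measure.sum fun m => geomWeight θ m • (Measure.dirac m).prod (streamLaw ν₀ ν₁ m)

theorem jointLaw_singleton_prod (θ : ℝ) (m : ℕ) {B : Set (ℕ → E)} (hB : MeasurableSet B) :
    jointLaw ν₀ ν₁ θ ({m} ×ˢ B) = geomWeight θ m * streamLaw ν₀ ν₁ m B := by
  rw [jointLaw, Measure.sum_apply _ ((measurableSet_singleton m).prod hB), tsum_eq_single m]
  · simp [Measure.prod_prod]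
  · intro n hn
    simp [Measure.prod_prod, hn]

theorem isProbabilityMeasure_jointLaw {θ : ℝ} (h0 : 0 < θ) (h1 : θ < 1) :
    IsProbabilityMeasure (jointLaw ν₀ ν₁ θ) :=
  ⟨by simp [jointLaw, Measure.sum_apply, tsum_geomWeight h0 h1]⟩

/-- The boxes `{m} × B`. -/
def singletonBoxes (E : Type*) [MeasurableSpace E] : Set (Set (ℕ × (ℕ → E))) :=
  {s | ∃ (m : ℕ) (B : Set (ℕ → E)), MeasurableSet B ∧ s = {m} ×ˢ B}

/-- Change points are countable, so a measurable set is the countable union of its slices. Such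
boxes fit a model that is specified conditionally on exact change points. -/
theorem generateFrom_singletonBoxes :
    MeasurableSpace.generateFrom (singletonBoxes E) = Prod.instMeasurableSpace := by
  refine le_antisymm (MeasurableSpace.generateFrom_le ?_) fun s hs => ?_
  · rintro _ ⟨m, B, hB, rfl⟩
    exact (measurableSet_singleton m).prod hB
  · have : s = ⋃ m : ℕ, {m} ×ˢ (Prod.mk m ⁻¹' s) := by
      ext ⟨n, x⟩
      simp
    rw [this]
    exact MeasurableSet.iUnion fun m =>
      MeasurableSpace.measurableSet_generateFrom ⟨m, _, measurable_prodMk_left hs, rfl⟩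

theorem isPiSystem_singletonBoxes : IsPiSystem (singletonBoxes E) := by
  rintro _ ⟨m, B, hB, rfl⟩ _ ⟨m', B', hB', rfl⟩ ⟨⟨n, x⟩, h, h'⟩
  obtain rfl : n = m := h.1
  obtain rfl : n = m' := h'.1
  exact ⟨n, B ∩ B', hB.inter hB', by rw [Set.prod_inter_prod, Set.inter_self]⟩

/-- The change points `T k` and the observations `Y k` of the streams are independent over `k`,
and have the law of the change-point model. -/
structure IsStreamModel {Ω : Type*} [MeasurableSpace Ω] (P : Measure Ω) (θ : ℝ)
    (T : ℕ → Ω → ℕ) (Y : ℕ → Ω → ℕ → E) : Prop where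
  measurable_changePoint : ∀ k, Measurable (T k)
  measurable_obs : ∀ k, Measurable (Y k)
  map_eq : ∀ k, P.map (fun ω => (T k ω, Y k ω)) = jointLaw ν₀ ν₁ θ
  indep : iIndepFun (fun k ω => (T k ω, Y k ω)) P

theorem isProbabilityMeasure_densityLaw {μ : Measure E} {f : E → ℝ} (hf : IsDensity μ f) :
    IsProbabilityMeasure (densityLaw μ f) :=
  ⟨by rw [densityLaw, withDensity_apply _ MeasurableSet.univ, Measure.restrict_univ,
    hf.lintegral_eq_one]⟩

end StreamLaw

/-! ### The joint law of finitely many streams under the model -/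

section OfIsModel

variable {Ω E : Type*} [MeasurableSpace Ω] [MeasurableSpace E] {P : Measure Ω}
  {μ : Measure E} {p q : E → ℝ} {θ : ℝ}

/-- The observations of a stream, indexed from `0`. -/
def obsPath (X : ℕ → Ω → E) (ω : Ω) (i : ℕ) : E := X (i + 1) ω

variable {K : ℕ} {τ : Fin K → Ω → ℕ∞} {X : Fin K → ℕ → Ω → E}

theorem IsModel.measurable_obsPath (h : IsModel P μ p q θ τ X) (k : Fin K) :
    Measurable (obsPath (X k)) :=
  measurable_pi_lambda _ fun i => h.measurable_obs k (i + 1) (Nat.le_add_left 1 i)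

theorem IsModel.measurableSet_changePointEvent (h : IsModel P μ p q θ τ X) (m : Fin K → ℕ) :
    MeasurableSet (changePointEvent τ m) := by
  have : changePointEvent τ m = ⋂ k, τ k ⁻¹' {(m k : ℕ∞)} := by
    ext ω
    simp [changePointEvent]
  rw [this]
  exact MeasurableSet.iInter fun k => h.measurable_changePoint k (measurableSet_singleton _)

theorem IsModel.measure_changePointEvent (h : IsModel P μ p q θ τ X) (m : Fin K → ℕ) :
    P (changePointEvent τ m) = ∏ k, geomWeight θ (m k) := by
  have h1 := h.indep_changePoint.measure_inter_preimage_eq_mul Finset.univ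
    (sets := fun k => {(m k : ℕ∞)}) fun k _ => measurableSet_singleton _
  have : changePointEvent τ m = ⋂ k ∈ Finset.univ, τ k ⁻¹' {(m k : ℕ∞)} := by
    ext ω
    simp [changePointEvent]
  rw [this, h1]
  exact Finset.prod_congr rfl fun k _ => h.law_changePoint k (m k)

variable [IsProbabilityMeasure P]

/-- The geometric weights already sum to `1`, leaving no mass for a change point at infinity. -/
theorem IsModel.ae_changePoint_ne_top (h : IsModel P μ p q θ τ X) (k : Fin K) :
    ∀ᵐ ω ∂P, τ k ω ≠ ⊤ := by
  have h1 : ∑' m : ℕ, P (τ k ⁻¹' {(m : ℕ∞)}) = 1 := by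
    rw [← tsum_geomWeight h.theta_pos h.theta_lt_one]
    exact tsum_congr fun m => h.law_changePoint k m
  rw [← measure_iUnion] at h1
  · rw [← prob_compl_eq_zero_iff] at h1
    · refine measure_mono_null (fun ω hω => ?_) h1
      simp only [Set.mem_compl_iff, not_not, Set.mem_ofPred_eq, ne_eq] at hω
      simp [hω]
    · exact MeasurableSet.iUnion fun m => h.measurable_changePoint k (measurableSet_singleton _)
  · intro a b hab
    refine Disjoint.preimage _ ?_
    simpa using hab
  · exact fun m => h.measurable_changePoint k (measurableSet_singleton _)

theorem IsModel.isProbabilityMeasure_cond (h : IsModel P μ p q θ τ X) (m : Fin K → ℕ) :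
    IsProbabilityMeasure (cond P (changePointEvent τ m)) := by
  refine cond_isProbabilityMeasure ?_
  rw [h.measure_changePointEvent]
  exact Finset.prod_ne_zero_iff.2 fun k _ => (geomWeight_pos h.theta_pos h.theta_lt_one _).ne'

variable [IsProbabilityMeasure (densityLaw μ p)] [IsProbabilityMeasure (densityLaw μ q)]

/-- Conditional independence over pairs (stream, time) is a product law indexed by pairs; currying
regroups it into a product over streams of path laws. -/
theorem IsModel.map_cond (h : IsModel P μ p q θ τ X) (m : Fin K → ℕ) :
    (cond P (changePointEvent τ m)).map (fun ω k => obsPath (X k) ω) =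
      Measure.pi fun k => streamLaw (densityLaw μ p) (densityLaw μ q) (m k) := by
  have := h.isProbabilityMeasure_cond m
  have hm : ∀ i : Fin K × ℕ, Measurable (X i.1 (i.2 + 1)) :=
    fun i => h.measurable_obs _ _ (Nat.le_add_left 1 _)
  have h1 := (h.indep_obs m).map_fun_eq_infinitePi_map hm
  have h2 : (fun i : Fin K × ℕ => (cond P (changePointEvent τ m)).map (X i.1 (i.2 + 1))) =
      fun i => if i.2 + 1 ≤ m i.1 then densityLaw μ p else densityLaw μ q := by
    funext i
    rw [h.law_obs m i.1 (i.2 + 1) (Nat.le_add_left 1 _)]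
  have h3 := Measure.infinitePi_map_curry
    (fun (k : Fin K) (i : ℕ) => if i + 1 ≤ m k then densityLaw μ p else densityLaw μ q)
  simp only [h2] at h1
  rw [← h1, Measure.map_map (MeasurableEquiv.measurable _) (measurable_pi_lambda _ hm),
    Measure.infinitePi_eq_pi] at h3
  exact h3

theorem IsModel.map_eq_pi (h : IsModel P μ p q θ τ X) :
    P.map (fun ω k => ((τ k ω).toNat, obsPath (X k) ω)) =
      Measure.pi fun _ : Fin K => jointLaw (densityLaw μ p) (densityLaw μ q) θ := by
  have := isProbabilityMeasure_jointLaw (densityLaw μ p) (densityLaw μ q) h.theta_pos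
    h.theta_lt_one
  have hT : ∀ k, Measurable fun ω => (τ k ω).toNat := fun k =>
    (measurable_of_countable ENat.toNat).comp (h.measurable_changePoint k)
  symm
  refine Measure.pi_eq_generateFrom (C := fun _ => singletonBoxes E)
    (fun _ => generateFrom_singletonBoxes) (fun _ => isPiSystem_singletonBoxes)
    (fun _ => ⟨fun n => {n} ×ˢ Set.univ, fun n => ⟨n, _, MeasurableSet.univ, rfl⟩,
      fun n => measure_lt_top _ _, by ext ⟨n, x⟩; simp⟩) fun s hs => ?_
  choose m B hB hs using hs
  obtain rfl : s = fun k => {m k} ×ˢ B k := funext hs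
  simp only [jointLaw_singleton_prod _ _ _ _ (hB _)]
  have hm : Measurable fun ω k => ((τ k ω).toNat, obsPath (X k) ω) :=
    measurable_pi_lambda _ fun k => (hT k).prodMk (h.measurable_obsPath k)
  rw [Measure.map_apply hm (MeasurableSet.univ_pi fun k => (measurableSet_singleton _).prod (hB k))]
  -- `toNat` sends `⊤` to `0`, so the two events agree only up to the null event of an infinite
  -- change point.
  have hpre : (fun ω k => ((τ k ω).toNat, obsPath (X k) ω)) ⁻¹'
      Set.univ.pi (fun k => {m k} ×ˢ B k) =ᵐ[P]
      (changePointEvent τ m ∩ (fun ω k => obsPath (X k) ω) ⁻¹' Set.univ.pi B : Set Ω) := by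
    filter_upwards [ae_all_iff.2 h.ae_changePoint_ne_top] with ω hω
    have e : ∀ k, (τ k ω).toNat = m k ↔ τ k ω = m k := fun k => by
      constructor
      · intro hk
        rw [← hk, ENat.natCast_toNat (hω k)]
      · intro hk
        rw [hk, ENat.toNat_natCast]
    refine propext ?_
    change (∀ k, k ∈ Set.univ → _) ↔ (∀ k, _) ∧ (∀ k, k ∈ Set.univ → _)
    simp only [Set.mem_univ, true_imp_iff, Set.mem_prod, Set.mem_singleton_iff, e, forall_and]
  rw [measure_congr hpre, ← cond_mul_eq_inter (h.measurableSet_changePointEvent m),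
    ← Measure.map_apply (measurable_pi_lambda _ h.measurable_obsPath) (MeasurableSet.univ_pi hB),
    h.map_cond, Measure.pi_pi, h.measure_changePointEvent, Finset.prod_mul_distrib, mul_comm]

end OfIsModel

theorem isStreamModel_of_isModel {Ω E : Type*} [MeasurableSpace Ω] [MeasurableSpace E]
    {P : Measure Ω} [IsProbabilityMeasure P] {μ : Measure E} {p q : E → ℝ} {θ : ℝ}
    [IsProbabilityMeasure (densityLaw μ p)] [IsProbabilityMeasure (densityLaw μ q)]
    {τ : ℕ → Ω → ℕ∞} {X : ℕ → ℕ → Ω → E}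
    (hmodel : ∀ K : ℕ, IsModel P μ p q θ (fun k : Fin K => τ k) (fun k : Fin K => X k)) :
    IsStreamModel (densityLaw μ p) (densityLaw μ q) P θ (fun k ω => (τ k ω).toNat)
      (fun k => obsPath (X k)) := by
  have hθ := hmodel 0
  have := isProbabilityMeasure_jointLaw (densityLaw μ p) (densityLaw μ q) hθ.theta_pos
    hθ.theta_lt_one
  have hT : ∀ k, Measurable fun ω => (τ k ω).toNat := fun k =>
    (measurable_of_countable ENat.toNat).comp
      ((hmodel (k + 1)).measurable_changePoint (Fin.last k))
  have hY : ∀ k, Measurable (obsPath (X k)) := fun k =>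
    (hmodel (k + 1)).measurable_obsPath (Fin.last k)
  have hlaw : ∀ k, P.map (fun ω => ((τ k ω).toNat, obsPath (X k) ω)) =
      jointLaw (densityLaw μ p) (densityLaw μ q) θ := fun k => by
    have h1 := congrArg (Measure.map (Function.eval (Fin.last k))) (hmodel (k + 1)).map_eq_pi
    rw [(measurePreserving_eval
      (fun _ : Fin (k + 1) => jointLaw (densityLaw μ p) (densityLaw μ q) θ) _).map_eq,
      Measure.map_map (measurable_pi_apply _)] at h1
    · exact h1
    · exact measurable_pi_lambda _ fun k => (hT k).prodMk (hY k)
  refine ⟨hT, hY, hlaw, ?_⟩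
  have hfin : ∀ K, iIndepFun (fun (k : Fin K) ω => ((τ k ω).toNat, obsPath (X k) ω)) P := by
    intro K
    rw [iIndepFun_iff_map_fun_eq_pi_map fun k : Fin K => ((hT k).prodMk (hY k)).aemeasurable,
      (hmodel K).map_eq_pi]
    simp only [hlaw]
  rw [iIndepFun_iff_finset]
  -- Independence of the infinite family concerns finite subfamilies, and each of them sits among
  -- the first `s.sup id + 1` streams.
  intro s
  exact (hfin (s.sup id + 1)).precomp
    (g := fun i : s => ⟨i, Nat.lt_succ_of_le (Finset.le_sup (f := id) i.2)⟩)
    fun i j hij => Subtype.ext (by simpa using hij)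

/-! ### Truncated paths and their laws before and after the change point -/

section Trunc

variable {E : Type*}

/-- The path that agrees with `x` before `t` and is constant equal to `e` from `t` on. -/
def trunc (e : E) (t : ℕ) (x : ℕ → E) (i : ℕ) : E := if i < t then x i else e

/-- Truncated paths of all lengths share one space, and a new observation is an update at a single
index. This drives every recursion below. -/
theorem trunc_succ (e : E) (t : ℕ) (x : ℕ → E) :
    trunc e (t + 1) x = Function.update (trunc e t x) t (x t) := by
  funext i
  rcases lt_trichotomy i t with h | rfl | h
  · simp [trunc, h, h.ne, h.trans (Nat.lt_succ_self t)]
  · simp [trunc]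
  · simp [trunc, h.ne', not_lt.2 h.le, not_lt.2 (Nat.succ_le_of_lt h)]

theorem trunc_trunc (e : E) {s t : ℕ} (h : s ≤ t) (x : ℕ → E) :
    trunc e s (trunc e t x) = trunc e s x := by
  funext i
  by_cases hi : i < s
  · simp [trunc, hi, hi.trans_le h]
  · simp [trunc, hi]

theorem trunc_update (e : E) (t : ℕ) (x : ℕ → E) (y : E) :
    trunc e t (Function.update x t y) = trunc e t x := by
  funext i
  by_cases hi : i < t
  · simp [trunc, hi, hi.ne]
  · simp [trunc, hi]

variable [MeasurableSpace E]

theorem measurable_trunc (e : E) (t : ℕ) : Measurable (trunc e t) :=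
  measurable_pi_lambda _ fun i => by
    by_cases hi : i < t
    · simpa [trunc, hi] using measurable_pi_apply i
    · simp [trunc, hi]

theorem measurable_update_pair (t : ℕ) :
    Measurable fun z : (ℕ → E) × E => Function.update z.1 t z.2 :=
  measurable_pi_lambda _ fun i => by
    by_cases hi : i = t
    · subst hi
      simpa using measurable_snd
    · simp only [Function.update_of_ne hi]
      exact (measurable_pi_apply i).comp measurable_fst

variable (ν₀ ν₁ : Measure E) [IsProbabilityMeasure ν₀] [IsProbabilityMeasure ν₁]

/-- With a change point at or after `t`, the first `t` observations all follow `ν₀`, whatever the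
change point is. -/
theorem map_trunc_streamLaw_congr (e : E) {t m m' : ℕ} (hm : t ≤ m) (hm' : t ≤ m') :
    (streamLaw ν₀ ν₁ m).map (trunc e t) = (streamLaw ν₀ ν₁ m').map (trunc e t) := by
  have key : ∀ m, t ≤ m → (streamLaw ν₀ ν₁ m).map (trunc e t) =
      Measure.infinitePi fun i => if i < t then ν₀ else Measure.dirac e := by
    intro m hm
    have h1 : ∀ i : ℕ, Measurable fun y : E => if i < t then y else e := fun i => by
      by_cases hi : i < t
      · simp only [hi, if_true]
        exact measurable_id
      · simp [hi]
    have h2 := Measure.infinitePi_map_pi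
      (μ := fun i => if i + 1 ≤ m then ν₀ else ν₁) (f := fun i y => if i < t then y else e) h1
    have h3 : ∀ i, (if i + 1 ≤ m then ν₀ else ν₁).map (fun y : E => if i < t then y else e) =
        if i < t then ν₀ else Measure.dirac e := fun i => by
      by_cases hi : i < t
      · simp [hi, show i + 1 ≤ m by omega]
      · simp [hi, Measure.map_const]
    simp only [h3] at h2
    exact h2
  rw [key m hm, key m' hm']

theorem lintegral_map_trunc_succ (e : E) (t m : ℕ) {f : (ℕ → E) → ENNReal} (hf : Measurable f) :
    ∫⁻ x, f x ∂(streamLaw ν₀ ν₁ m).map (trunc e (t + 1)) =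
      ∫⁻ x, ∫⁻ y, f (Function.update x t y) ∂(if t + 1 ≤ m then ν₀ else ν₁)
        ∂(streamLaw ν₀ ν₁ m).map (trunc e t) := by
  have hind : iIndepFun (fun (i : ℕ) (x : ℕ → E) => x i) (streamLaw ν₀ ν₁ m) :=
    iIndepFun_infinitePi (P := fun i => if i + 1 ≤ m then ν₀ else ν₁) (X := fun _ y => y)
      fun _ => measurable_id
  have h1 := hind.indepFun_finset (Finset.range t) {t} (by simp) measurable_pi_apply
  have h2 : IndepFun (trunc e t) (fun x : ℕ → E => x t) (streamLaw ν₀ ν₁ m) := by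
    have hφ : Measurable fun (z : Finset.range t → E) (i : ℕ) =>
        if h : i ∈ Finset.range t then z ⟨i, h⟩ else e :=
      measurable_pi_lambda _ fun i => by
        by_cases h : i ∈ Finset.range t
        · simpa [h] using measurable_pi_apply _
        · simp [h]
    have hψ : Measurable fun z : ({t} : Finset ℕ) → E => z ⟨t, by simp⟩ := measurable_pi_apply _
    have h3 := h1.comp hφ hψ
    have e1 : (fun (z : Finset.range t → E) (i : ℕ) =>
        if h : i ∈ Finset.range t then z ⟨i, h⟩ else e) ∘
        (fun (x : ℕ → E) (i : Finset.range t) => x i) = trunc e t := by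
      funext x i
      simp [trunc]
    rwa [e1] at h3
  have h3 := h2.map_prod_eq_prod_map_map (measurable_trunc e t).aemeasurable
    (measurable_pi_apply t).aemeasurable
  have h4 : (streamLaw ν₀ ν₁ m).map (fun x : ℕ → E => x t) = if t + 1 ≤ m then ν₀ else ν₁ :=
    Measure.infinitePi_map_eval (fun i => if i + 1 ≤ m then ν₀ else ν₁) t
  rw [h4] at h3
  have := Measure.isProbabilityMeasure_map (μ := streamLaw ν₀ ν₁ m)
    (measurable_trunc e t).aemeasurable
  rw [← lintegral_prod (fun z : (ℕ → E) × E => f (Function.update z.1 t z.2))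
    (hf.comp (measurable_update_pair t)).aemeasurable, ← h3,
    lintegral_map (f := fun z : (ℕ → E) × E => f (Function.update z.1 t z.2))
      (hf.comp (measurable_update_pair t))
      ((measurable_trunc e t).prodMk (measurable_pi_apply t)),
    lintegral_map hf (measurable_trunc e (t + 1))]
  simp only [trunc_succ]

/-- The law of the path truncated at time `t`, restricted to the event that the change point is
strictly before `t`. -/
noncomputable def postLaw (θ : ℝ) (e : E) (t : ℕ) : Measure (ℕ → E) :=
  ∑ m ∈ Finset.range t, geomWeight θ m • (streamLaw ν₀ ν₁ m).map (trunc e t)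

/-- The law of the path truncated at time `t`, restricted to the event that the change point is at
least `t`. -/
noncomputable def preLaw (θ : ℝ) (e : E) (t : ℕ) : Measure (ℕ → E) :=
  ENNReal.ofReal ((1 - θ) ^ t) • (streamLaw ν₀ ν₁ t).map (trunc e t)

variable {θ : ℝ}

/-- A change before `t + 1` happened before `t` or at `t`; the latter takes the fraction `θ` of the
event of no earlier change, by memorylessness. In both cases the observation at time `t + 1`, stored
at index `t`, follows `ν₁`. -/
theorem lintegral_postLaw_succ (h0 : 0 < θ) (e : E) (t : ℕ)
    {f : (ℕ → E) → ENNReal} (hf : Measurable f) :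
    ∫⁻ x, f x ∂postLaw ν₀ ν₁ θ e (t + 1) =
      ∫⁻ x, ∫⁻ y, f (Function.update x t y) ∂ν₁ ∂postLaw ν₀ ν₁ θ e t +
        ENNReal.ofReal θ * ∫⁻ x, ∫⁻ y, f (Function.update x t y) ∂ν₁ ∂preLaw ν₀ ν₁ θ e t := by
  have key : ∀ m ≤ t, ∫⁻ x, f x ∂(streamLaw ν₀ ν₁ m).map (trunc e (t + 1)) =
      ∫⁻ x, ∫⁻ y, f (Function.update x t y) ∂ν₁ ∂(streamLaw ν₀ ν₁ m).map (trunc e t) := by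
    intro m hm
    rw [lintegral_map_trunc_succ ν₀ ν₁ e t m hf, if_neg (by omega)]
  simp only [postLaw, preLaw, lintegral_finsetSum_measure, lintegral_smul_measure, smul_eq_mul]
  rw [Finset.sum_range_succ, key t le_rfl, ← mul_assoc, ← ENNReal.ofReal_mul h0.le]
  congr 1
  exact Finset.sum_congr rfl fun m hm => by rw [key m (Finset.mem_range.1 hm).le]

theorem lintegral_preLaw_succ (h1 : θ < 1) (e : E) (t : ℕ)
    {f : (ℕ → E) → ENNReal} (hf : Measurable f) :
    ∫⁻ x, f x ∂preLaw ν₀ ν₁ θ e (t + 1) =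
      ENNReal.ofReal (1 - θ) *
        ∫⁻ x, ∫⁻ y, f (Function.update x t y) ∂ν₀ ∂preLaw ν₀ ν₁ θ e t := by
  simp only [preLaw, lintegral_smul_measure, smul_eq_mul]
  rw [lintegral_map_trunc_succ ν₀ ν₁ e t (t + 1) hf, if_pos le_rfl,
    map_trunc_streamLaw_congr ν₀ ν₁ e (Nat.le_succ t) le_rfl, ← mul_assoc,
    ← ENNReal.ofReal_mul (by linarith), pow_succ']

theorem jointLaw_lt_inter (e : E) (t : ℕ) {B : Set (ℕ → E)} (hB : MeasurableSet B) :
    jointLaw ν₀ ν₁ θ {z | z.1 < t ∧ trunc e t z.2 ∈ B} = postLaw ν₀ ν₁ θ e t B := by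
  have h : {z : ℕ × (ℕ → E) | z.1 < t ∧ trunc e t z.2 ∈ B} =
      ⋃ m ∈ Finset.range t, {m} ×ˢ (trunc e t ⁻¹' B) := by
    ext ⟨n, x⟩
    simp
  rw [h, measure_biUnion_finset]
  · simp only [postLaw, Measure.coe_finsetSum, Finset.sum_apply, Measure.smul_apply, smul_eq_mul]
    refine Finset.sum_congr rfl fun m _ => ?_
    rw [jointLaw_singleton_prod _ _ _ _ (measurable_trunc e t hB),
      Measure.map_apply (measurable_trunc e t) hB]
  · intro m _ m' _ hne
    exact Set.disjoint_left.2 fun z hz hz' => hne ((Set.mem_prod.1 hz).1.symm.trans hz'.1)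
  · exact fun m _ => (measurableSet_singleton m).prod (measurable_trunc e t hB)

/-- All change points at or after `t` induce the same truncated law, so their weights add up to the
geometric tail `(1 - θ) ^ t`. -/
theorem jointLaw_ge_inter (h0 : 0 < θ) (h1 : θ < 1) (e : E) (t : ℕ) {B : Set (ℕ → E)}
    (hB : MeasurableSet B) :
    jointLaw ν₀ ν₁ θ {z | t ≤ z.1 ∧ trunc e t z.2 ∈ B} = preLaw ν₀ ν₁ θ e t B := by
  have h : {z : ℕ × (ℕ → E) | t ≤ z.1 ∧ trunc e t z.2 ∈ B} =
      ⋃ m : ℕ, {t + m} ×ˢ (trunc e t ⁻¹' B) := by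
    ext ⟨n, x⟩
    simp [le_iff_exists_add]
  have hw : ∀ m, geomWeight θ (t + m) = ENNReal.ofReal ((1 - θ) ^ t) * geomWeight θ m := by
    intro m
    rw [geomWeight, geomWeight, ← ENNReal.ofReal_mul (pow_nonneg (by linarith) _), pow_add]
    congr 1
    ring
  rw [h, measure_iUnion]
  · have : ∀ m, jointLaw ν₀ ν₁ θ ({t + m} ×ˢ (trunc e t ⁻¹' B)) =
        geomWeight θ m * (ENNReal.ofReal ((1 - θ) ^ t) *
          (streamLaw ν₀ ν₁ t).map (trunc e t) B) := fun m => by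
      rw [jointLaw_singleton_prod _ _ _ _ (measurable_trunc e t hB),
        ← Measure.map_apply (measurable_trunc e t) hB,
        map_trunc_streamLaw_congr ν₀ ν₁ e (Nat.le_add_right t m) le_rfl, hw]
      ring
    simp only [this]
    rw [ENNReal.tsum_mul_right, tsum_geomWeight h0 h1, one_mul, preLaw, Measure.smul_apply,
      smul_eq_mul]
  · intro m m' hne
    exact Set.disjoint_left.2 fun z hz hz' => hne (by
      have := (Set.mem_prod.1 hz).1.symm.trans hz'.1
      simpa using this)
  · exact fun m => (measurableSet_singleton _).prod (measurable_trunc e t hB)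

/-- The law of the observations of a stream. -/
noncomputable def obsLaw (θ : ℝ) : Measure (ℕ → E) := (jointLaw ν₀ ν₁ θ).map Prod.snd

theorem isProbabilityMeasure_obsLaw (h0 : 0 < θ) (h1 : θ < 1) :
    IsProbabilityMeasure (obsLaw ν₀ ν₁ θ) :=
  have := isProbabilityMeasure_jointLaw ν₀ ν₁ h0 h1
  Measure.isProbabilityMeasure_map measurable_snd.aemeasurable

theorem map_trunc_obsLaw (h0 : 0 < θ) (h1 : θ < 1) (e : E) (t : ℕ) :
    (obsLaw ν₀ ν₁ θ).map (trunc e t) = postLaw ν₀ ν₁ θ e t + preLaw ν₀ ν₁ θ e t := by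
  ext B hB
  rw [Measure.map_apply (measurable_trunc e t) hB, obsLaw,
    Measure.map_apply measurable_snd (measurable_trunc e t hB), Measure.add_apply,
    ← jointLaw_lt_inter ν₀ ν₁ e t hB, ← jointLaw_ge_inter ν₀ ν₁ h0 h1 e t hB,
    ← measure_union]
  · congr 1
    ext z
    simp only [Set.mem_preimage, Set.mem_union, Set.mem_ofPred_eq, ← or_and_right]
    simp [lt_or_ge]
  · exact Set.disjoint_left.2 fun z hz hz' => absurd hz.1 (not_lt.2 hz'.1)
  · exact (measurableSet_le measurable_const measurable_fst).inter
      (measurable_snd (measurable_trunc e t hB))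

end Trunc

/-! ### The posterior probability process of a single stream -/

section Posterior

/-- The update of the posterior probability `v` after an observation with likelihood ratio `r`. -/
noncomputable def posteriorUpdate (θ v r : ℝ) : ℝ :=
  r / ((1 - θ) * (1 - v) / (θ + (1 - θ) * v) + r)

variable {θ : ℝ}

theorem odds_pos (h0 : 0 < θ) (h1 : θ < 1) {v : ℝ} (hv : v ∈ Set.Ico (0 : ℝ) 1) :
    0 < (1 - θ) * (1 - v) / (θ + (1 - θ) * v) :=
  div_pos (mul_pos (by linarith) (by linarith [hv.2]))
    (add_pos_of_pos_of_nonneg h0 (mul_nonneg (by linarith) hv.1))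

theorem posteriorUpdate_mem_Ico (h0 : 0 < θ) (h1 : θ < 1) {v r : ℝ}
    (hv : v ∈ Set.Ico (0 : ℝ) 1) (hr : 0 ≤ r) : posteriorUpdate θ v r ∈ Set.Ico (0 : ℝ) 1 := by
  have hC := odds_pos h0 h1 hv
  exact ⟨div_nonneg hr (by linarith), (div_lt_one (by linarith)).2 (by linarith)⟩

/-- With prior odds `C` against a change, both sides are `C r / (C + r)`. The identity converts an
integral against `ν₁ = L ν₀` into one against `ν₀`. -/
theorem mul_one_sub_posteriorUpdate (h0 : 0 < θ) (h1 : θ < 1) {v r : ℝ}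
    (hv : v ∈ Set.Ico (0 : ℝ) 1) (hr : 0 ≤ r) :
    r * (1 - posteriorUpdate θ v r) =
      (1 - θ) * (1 - v) / (θ + (1 - θ) * v) * posteriorUpdate θ v r := by
  have hC := odds_pos h0 h1 hv
  unfold posteriorUpdate
  generalize (1 - θ) * (1 - v) / (θ + (1 - θ) * v) = C at *
  have : C + r ≠ 0 := by linarith
  field_simp
  ring

theorem measurable_posteriorUpdate : Measurable fun z : ℝ × ℝ => posteriorUpdate θ z.1 z.2 := by
  unfold posteriorUpdate
  fun_prop

variable {E : Type*}

/-- The posterior probability of a change strictly before time `t` along a path of observations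
indexed from `0`, for the likelihood ratio `L`. -/
noncomputable def posterior (θ : ℝ) (L : E → ℝ) : ℕ → (ℕ → E) → ℝ
  | 0, _ => 0
  | t + 1, x => posteriorUpdate θ (posterior θ L t x) (L (x t))

variable {L : E → ℝ}

theorem posterior_mem_Ico (h0 : 0 < θ) (h1 : θ < 1) (hL : ∀ y, 0 ≤ L y) (t : ℕ) (x : ℕ → E) :
    posterior θ L t x ∈ Set.Ico (0 : ℝ) 1 := by
  induction t with
  | zero => simp [posterior]
  | succ t ih => exact posteriorUpdate_mem_Ico h0 h1 ih (hL _)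

theorem posterior_congr {t : ℕ} {x y : ℕ → E} (h : ∀ i < t, x i = y i) :
    posterior θ L t x = posterior θ L t y := by
  induction t with
  | zero => rfl
  | succ t ih =>
    rw [posterior, posterior, ih fun i hi => h i (hi.trans (Nat.lt_succ_self t)),
      h t (Nat.lt_succ_self t)]

theorem posterior_trunc (e : E) {s t : ℕ} (h : s ≤ t) (x : ℕ → E) :
    posterior θ L s (trunc e t x) = posterior θ L s x :=
  posterior_congr fun i hi => by simp [trunc, hi.trans_le h]

theorem posterior_update (t : ℕ) (x : ℕ → E) (y : E) :
    posterior θ L t (Function.update x t y) = posterior θ L t x :=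
  posterior_congr fun i hi => by simp [hi.ne]

theorem posterior_succ_update (t : ℕ) (x : ℕ → E) (y : E) :
    posterior θ L (t + 1) (Function.update x t y) =
      posteriorUpdate θ (posterior θ L t x) (L y) := by
  rw [posterior, posterior_update, Function.update_self]

/-- `B` depends only on the observations before time `t`. -/
def IsHistory (e : E) (t : ℕ) (B : Set (ℕ → E)) : Prop := ∀ x, trunc e t x ∈ B ↔ x ∈ B

theorem IsHistory.mono {e : E} {s t : ℕ} {B : Set (ℕ → E)} (h : IsHistory e s B) (hst : s ≤ t) :
    IsHistory e t B := fun x => by rw [← h, trunc_trunc e hst, h]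

theorem IsHistory.preimage {e : E} {t : ℕ} {B : Set (ℕ → E)} (h : IsHistory e t B) :
    trunc e t ⁻¹' B = B := Set.ext h

theorem IsHistory.update_mem {e : E} {t : ℕ} {B : Set (ℕ → E)} (h : IsHistory e t B)
    (x : ℕ → E) (y : E) : Function.update x t y ∈ B ↔ x ∈ B := by
  rw [← h, trunc_update, h]

theorem exists_Ioo_subset_posteriorUpdate {v l l' : ℝ} (h0 : 0 < θ) (h1 : θ < 1)
    (hv : v ∈ Set.Ico (0 : ℝ) 1) (hl : 0 ≤ l) (hll : l < l') (hl' : l' ≤ 1) :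
    ∃ a b, 0 ≤ a ∧ a < b ∧ ∀ r ∈ Set.Ioo a b, posteriorUpdate θ v r ∈ Set.Ioc l l' := by
  have hC := odds_pos h0 h1 hv
  unfold posteriorUpdate
  generalize (1 - θ) * (1 - v) / (θ + (1 - θ) * v) = C at *
  -- The map `r ↦ r / (C + r)` is increasing with inverse `u ↦ C u / (1 - u)`. The intermediate `m`
  -- keeps this inverse finite when `l' = 1`.
  obtain ⟨m, hm1, hm2⟩ := exists_between hll
  have hl1 : 0 < 1 - l := by linarith
  have hm3 : 0 < 1 - m := by linarith
  refine ⟨C * l / (1 - l), C * m / (1 - m), by positivity, ?_, ?_⟩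
  · rw [div_lt_div_iff₀ hl1 hm3]
    nlinarith
  · rintro r ⟨hr1, hr2⟩
    rw [div_lt_iff₀ hl1] at hr1
    rw [lt_div_iff₀ hm3] at hr2
    have hr0 : 0 < r := by
      by_contra hc
      nlinarith [mul_nonneg hC.le hl]
    have hCr : 0 < C + r := by linarith
    constructor
    · rw [lt_div_iff₀ hCr]
      linarith
    · rw [div_le_iff₀ hCr]
      nlinarith

variable [MeasurableSpace E]

theorem measurable_posterior (hL : Measurable L) (t : ℕ) : Measurable (posterior θ L t) := by
  induction t with
  | zero => exact measurable_const
  | succ t ih =>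
    exact measurable_posteriorUpdate.comp (ih.prodMk (hL.comp (measurable_pi_apply t)))

variable {ν₀ ν₁ : Measure E} [IsProbabilityMeasure ν₀] [IsProbabilityMeasure ν₁]

theorem measurable_update_right (t : ℕ) (x : ℕ → E) : Measurable fun y => Function.update x t y :=
  (measurable_update_pair t).comp measurable_prodMk_left

/-- Bayes' formula: the posterior odds are the likelihood ratio of the laws of the truncated path
before and after the change. -/
theorem lintegral_one_sub_posterior_postLaw (h0 : 0 < θ) (h1 : θ < 1) (hL : Measurable L)
    (hL0 : ∀ y, 0 ≤ L y) (hν : ν₁ = ν₀.withDensity fun y => ENNReal.ofReal (L y)) (e : E)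
    (t : ℕ) : ∀ {g : (ℕ → E) → ENNReal}, Measurable g →
    ∫⁻ x, g x * ENNReal.ofReal (1 - posterior θ L t x) ∂postLaw ν₀ ν₁ θ e t =
      ∫⁻ x, g x * ENNReal.ofReal (posterior θ L t x) ∂preLaw ν₀ ν₁ θ e t := by
  induction t with
  | zero => intro g _; simp [postLaw, posterior]
  | succ t ih =>
    intro g hg
    have hV := measurable_posterior (θ := θ) hL t
    have hV1 := measurable_posterior (θ := θ) hL (t + 1)
    have hmem := posterior_mem_Ico (θ := θ) h0 h1 hL0 t
    rw [lintegral_postLaw_succ ν₀ ν₁ h0 e t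
        (f := fun x => g x * ENNReal.ofReal (1 - posterior θ L (t + 1) x)) (by fun_prop),
      lintegral_preLaw_succ ν₀ ν₁ h1 e t
        (f := fun x => g x * ENNReal.ofReal (posterior θ L (t + 1) x)) (by fun_prop)]
    simp only [posterior_succ_update]
    set V := posterior θ L t with hVdef
    have hφ : Measurable fun z : (ℕ → E) × E => posteriorUpdate θ (V z.1) (L z.2) :=
      measurable_posteriorUpdate.comp ((hV.comp measurable_fst).prodMk (hL.comp measurable_snd))
    set J : (ℕ → E) → ENNReal := fun x => ∫⁻ y, g (Function.update x t y) *
      ENNReal.ofReal (posteriorUpdate θ (V x) (L y)) ∂ν₀ with hJ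
    have hJm : Measurable J := Measurable.lintegral_prod_right
      (f := fun x y => g (Function.update x t y) * ENNReal.ofReal (posteriorUpdate θ (V x) (L y)))
      ((hg.comp (measurable_update_pair t)).mul hφ.ennreal_ofReal)
    have hinner : ∀ x, ∫⁻ y, g (Function.update x t y) *
        ENNReal.ofReal (1 - posteriorUpdate θ (V x) (L y)) ∂ν₁ =
        ENNReal.ofReal ((1 - θ) * (1 - V x) / (θ + (1 - θ) * V x)) * J x := by
      intro x
      have hm1 : Measurable fun y => g (Function.update x t y) :=
        hg.comp (measurable_update_right t x)
      have hm2 : Measurable fun y => posteriorUpdate θ (V x) (L y) :=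
        hφ.comp measurable_prodMk_left
      rw [hν, lintegral_withDensity_eq_lintegral_mul _ hL.ennreal_ofReal
        (g := fun y => g (Function.update x t y) *
          ENNReal.ofReal (1 - posteriorUpdate θ (V x) (L y)))
        (hm1.mul (hm2.const_sub 1).ennreal_ofReal), hJ,
        ← lintegral_const_mul (f := fun y => g (Function.update x t y) *
          ENNReal.ofReal (posteriorUpdate θ (V x) (L y))) _ (hm1.mul hm2.ennreal_ofReal)]
      refine lintegral_congr fun y => ?_
      simp only [Pi.mul_apply]
      rw [mul_left_comm, ← ENNReal.ofReal_mul (hL0 y), mul_one_sub_posteriorUpdate h0 h1 (hmem x)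
        (hL0 y), ENNReal.ofReal_mul (odds_pos h0 h1 (hmem x)).le, mul_left_comm]
    simp only [hinner]
    have hden : ∀ x, 0 < θ + (1 - θ) * V x := fun x =>
      add_pos_of_pos_of_nonneg h0 (mul_nonneg (by linarith) (hmem x).1)
    -- The induction hypothesis is used for the test function with the newest observation integrated
    -- out; its weight is chosen so that multiplying by `1 - V` restores the prior odds.
    have hih := ih (g := fun x => ENNReal.ofReal ((1 - θ) / (θ + (1 - θ) * V x)) * J x)
      (by fun_prop)
    have e1 : ∀ x, ENNReal.ofReal ((1 - θ) / (θ + (1 - θ) * V x)) * J x *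
        ENNReal.ofReal (1 - V x) =
        ENNReal.ofReal ((1 - θ) * (1 - V x) / (θ + (1 - θ) * V x)) * J x := fun x => by
      rw [mul_right_comm, ← ENNReal.ofReal_mul (div_nonneg (by linarith) (hden x).le)]
      congr 2
      ring
    simp only [e1] at hih
    rw [hih, ← lintegral_const_mul _ (by fun_prop), ← lintegral_add_left (by fun_prop),
      ← lintegral_const_mul _ hJm]
    refine lintegral_congr fun x => ?_
    have hv0 := (hmem x).1
    have hv1 := (hmem x).2
    rw [mul_right_comm, ← mul_assoc, ← add_mul,
      ← ENNReal.ofReal_mul (div_nonneg (by linarith) (hden x).le), ← ENNReal.ofReal_mul h0.le,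
      ← ENNReal.ofReal_add (mul_nonneg (div_nonneg (by linarith) (hden x).le) hv0)
        (mul_nonneg h0.le (odds_pos h0 h1 (hmem x)).le)]
    -- The two coefficients add up to `1 - θ` because `V + θ (1 - V) = θ + (1 - θ) V`.
    congr 2
    have := (hden x).ne'
    field_simp
    ring

/-- Adding `∫ g V` over the post-change law to both sides of Bayes' formula shows that `V_t` is the
density of the post-change law with respect to the law of the truncated path. -/
theorem lintegral_postLaw (h0 : 0 < θ) (h1 : θ < 1) (hL : Measurable L)
    (hL0 : ∀ y, 0 ≤ L y) (hν : ν₁ = ν₀.withDensity fun y => ENNReal.ofReal (L y)) (e : E)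
    (t : ℕ) {g : (ℕ → E) → ENNReal} (hg : Measurable g) :
    ∫⁻ x, g x ∂postLaw ν₀ ν₁ θ e t =
      ∫⁻ x, g (trunc e t x) * ENNReal.ofReal (posterior θ L t x) ∂obsLaw ν₀ ν₁ θ := by
  have hV := measurable_posterior (θ := θ) hL t
  have h2 : ∫⁻ x, g (trunc e t x) * ENNReal.ofReal (posterior θ L t x) ∂obsLaw ν₀ ν₁ θ =
      ∫⁻ x, g x * ENNReal.ofReal (posterior θ L t x)
        ∂(obsLaw ν₀ ν₁ θ).map (trunc e t) := by
    rw [lintegral_map (by fun_prop) (measurable_trunc e t)]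
    simp only [posterior_trunc e le_rfl]
  rw [h2, map_trunc_obsLaw ν₀ ν₁ h0 h1, lintegral_add_measure,
    ← lintegral_one_sub_posterior_postLaw h0 h1 hL hL0 hν e t hg,
    ← lintegral_add_left (by fun_prop)]
  refine lintegral_congr fun x => ?_
  have hmem := posterior_mem_Ico (θ := θ) h0 h1 hL0 t x
  rw [← mul_add, ← ENNReal.ofReal_add hmem.1 (by linarith [hmem.2])]
  simp

theorem postLaw_apply (h0 : 0 < θ) (h1 : θ < 1) (hL : Measurable L)
    (hL0 : ∀ y, 0 ≤ L y) (hν : ν₁ = ν₀.withDensity fun y => ENNReal.ofReal (L y)) {e : E}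
    {t : ℕ} {B : Set (ℕ → E)} (hB : MeasurableSet B) (hBt : IsHistory e t B) :
    postLaw ν₀ ν₁ θ e t B =
      ∫⁻ x in B, ENNReal.ofReal (posterior θ L t x) ∂obsLaw ν₀ ν₁ θ := by
  rw [← lintegral_indicator_one hB, lintegral_postLaw h0 h1 hL hL0 hν e t
    (measurable_one.indicator hB), ← lintegral_indicator hB]
  refine lintegral_congr fun x => ?_
  by_cases hx : x ∈ B <;> simp [hBt x, hx]

theorem obsLaw_apply (h0 : 0 < θ) (h1 : θ < 1) {e : E} {t : ℕ} {B : Set (ℕ → E)}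
    (hB : MeasurableSet B) (hBt : IsHistory e t B) :
    obsLaw ν₀ ν₁ θ B = postLaw ν₀ ν₁ θ e t B + preLaw ν₀ ν₁ θ e t B := by
  rw [← Measure.add_apply, ← map_trunc_obsLaw ν₀ ν₁ h0 h1,
    Measure.map_apply (measurable_trunc e t) hB, hBt.preimage]

theorem postLaw_succ_apply (h0 : 0 < θ) {e : E} {t : ℕ} {B : Set (ℕ → E)}
    (hB : MeasurableSet B) (hBt : IsHistory e t B) :
    postLaw ν₀ ν₁ θ e (t + 1) B =
      postLaw ν₀ ν₁ θ e t B + ENNReal.ofReal θ * preLaw ν₀ ν₁ θ e t B := by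
  rw [← lintegral_indicator_one hB, lintegral_postLaw_succ ν₀ ν₁ h0 e t
    (measurable_one.indicator hB), ← lintegral_indicator_one hB, ← lintegral_indicator_one hB]
  have key : ∀ x : ℕ → E, ∫⁻ y, B.indicator (1 : (ℕ → E) → ENNReal) (Function.update x t y) ∂ν₁ =
      B.indicator 1 x := fun x => by
    by_cases hx : x ∈ B <;> simp [hBt.update_mem, hx]
  simp only [key]

theorem integrable_posterior (h0 : 0 < θ) (h1 : θ < 1) (hL : Measurable L) (hL0 : ∀ y, 0 ≤ L y)
    (t : ℕ) (ν : Measure (ℕ → E)) [IsFiniteMeasure ν] : Integrable (posterior θ L t) ν := by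
  refine Integrable.of_bound (measurable_posterior hL t).aestronglyMeasurable 1
    (Eventually.of_forall fun x => ?_)
  have := posterior_mem_Ico (θ := θ) h0 h1 hL0 t x
  rw [Real.norm_eq_abs, abs_of_nonneg this.1]
  exact this.2.le

theorem postLaw_real_apply (h0 : 0 < θ) (h1 : θ < 1) (hL : Measurable L)
    (hL0 : ∀ y, 0 ≤ L y) (hν : ν₁ = ν₀.withDensity fun y => ENNReal.ofReal (L y)) {e : E}
    {t : ℕ} {B : Set (ℕ → E)} (hB : MeasurableSet B) (hBt : IsHistory e t B) :
    (postLaw ν₀ ν₁ θ e t).real B = ∫ x in B, posterior θ L t x ∂obsLaw ν₀ ν₁ θ := by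
  rw [integral_eq_lintegral_of_nonneg_ae
    (Eventually.of_forall fun x => (posterior_mem_Ico h0 h1 hL0 t x).1)
    (measurable_posterior hL t).aestronglyMeasurable, Measure.real,
    postLaw_apply h0 h1 hL hL0 hν hB hBt]

instance (e : E) (t : ℕ) : IsFiniteMeasure (preLaw ν₀ ν₁ θ e t) := by
  have := Measure.isProbabilityMeasure_map (μ := streamLaw ν₀ ν₁ t)
    (measurable_trunc e t).aemeasurable
  exact ⟨by simp [preLaw]⟩

instance (e : E) (t : ℕ) : IsFiniteMeasure (postLaw ν₀ ν₁ θ e t) := by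
  refine ⟨?_⟩
  simp only [postLaw, Measure.coe_finsetSum, Finset.sum_apply, Measure.smul_apply, smul_eq_mul]
  exact ENNReal.sum_lt_top.2 fun m _ =>
    ENNReal.mul_lt_top (geomWeight_ne_top θ m).lt_top (by
      rw [Measure.map_apply (measurable_trunc e t) MeasurableSet.univ]
      exact measure_lt_top _ _)

/-- The conditional mean of the next posterior probability given the history. -/
theorem setIntegral_posterior_succ (h0 : 0 < θ) (h1 : θ < 1) (hL : Measurable L)
    (hL0 : ∀ y, 0 ≤ L y) (hν : ν₁ = ν₀.withDensity fun y => ENNReal.ofReal (L y)) {e : E}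
    {t : ℕ} {B : Set (ℕ → E)} (hB : MeasurableSet B) (hBt : IsHistory e t B) :
    ∫ x in B, posterior θ L (t + 1) x ∂obsLaw ν₀ ν₁ θ =
      θ * (obsLaw ν₀ ν₁ θ).real B + (1 - θ) * ∫ x in B, posterior θ L t x ∂obsLaw ν₀ ν₁ θ := by
  -- Both integrals are masses of `B` under a change before `t + 1` and before `t`. Since `B` is
  -- decided by the first `t` observations, they differ by the fraction `θ` of the no-change part.
  rw [← postLaw_real_apply h0 h1 hL hL0 hν hB (hBt.mono (Nat.le_succ t)),
    ← postLaw_real_apply h0 h1 hL hL0 hν hB hBt]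
  simp only [Measure.real]
  rw [obsLaw_apply h0 h1 hB hBt, postLaw_succ_apply h0 hB hBt,
    ENNReal.toReal_add (measure_ne_top _ _) (measure_ne_top _ _),
    ENNReal.toReal_add (measure_ne_top _ _)
      (ENNReal.mul_ne_top ENNReal.ofReal_ne_top (measure_ne_top _ _)),
    ENNReal.toReal_mul, ENNReal.toReal_ofReal h0.le]
  ring

/-- The likelihood ratio has no atoms, and charges every nonempty open interval of the positive
half line. -/
structure IsSpread (ν : Measure E) (L : E → ℝ) : Prop where
  pos : ∀ᵐ y ∂ν, 0 < L y
  no_atom : ∀ c, ν {y | L y = c} = 0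
  charge : ∀ a b, 0 ≤ a → a < b → 0 < ν {y | L y ∈ Set.Ioo a b}

theorem measure_posteriorUpdate_eq {ν : Measure E} (hs : IsSpread ν L) {v : ℝ} (h0 : 0 < θ)
    (h1 : θ < 1) (hv : v ∈ Set.Ico (0 : ℝ) 1) (c : ℝ) :
    ν {y | posteriorUpdate θ v (L y) = c} = 0 := by
  have hC := odds_pos h0 h1 hv
  -- Solving `r / (C + r) = c` gives the single candidate `r = C c / (1 - c)`.
  refine measure_mono_null (t := {y | L y = (1 - θ) * (1 - v) / (θ + (1 - θ) * v) * c / (1 - c)} ∪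
    {y | ¬ 0 < L y}) ?_ (measure_union_null (hs.no_atom _) hs.pos)
  intro y hy
  simp only [Set.mem_ofPred_eq, Set.mem_union] at hy ⊢
  by_cases hy0 : 0 < L y
  · left
    unfold posteriorUpdate at hy
    generalize (1 - θ) * (1 - v) / (θ + (1 - θ) * v) = C at *
    have hCr : 0 < C + L y := by linarith
    have h1c : 1 - c = C / (C + L y) := by
      rw [← hy]
      field_simp
      ring
    rw [h1c, ← hy]
    field_simp
  · right
    exact hy0

/-- Whatever the past, the newest likelihood ratio is diffuse and the update is injective in it;
integrating over the past preserves this. -/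
theorem obsLaw_posterior_eq (h0 : 0 < θ) (h1 : θ < 1) (hL : Measurable L)
    (hL0 : ∀ y, 0 ≤ L y) (hs0 : IsSpread ν₀ L) (hs1 : IsSpread ν₁ L) (e : E) (t : ℕ) (c : ℝ) :
    obsLaw ν₀ ν₁ θ {x | posterior θ L (t + 1) x = c} = 0 := by
  have hB : MeasurableSet {x : ℕ → E | posterior θ L (t + 1) x = c} :=
    measurable_posterior hL (t + 1) (measurableSet_singleton c)
  have hBt : IsHistory e (t + 1) {x : ℕ → E | posterior θ L (t + 1) x = c} := fun x => by
    simp [posterior_trunc e le_rfl]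
  have key : ∀ ν : Measure E, IsSpread ν L → ∀ x : ℕ → E,
      ∫⁻ y, {x : ℕ → E | posterior θ L (t + 1) x = c}.indicator (1 : (ℕ → E) → ENNReal)
        (Function.update x t y) ∂ν = 0 := by
    intro ν hs x
    have hm : MeasurableSet {y | posteriorUpdate θ (posterior θ L t x) (L y) = c} :=
      (measurable_posteriorUpdate.comp (measurable_const.prodMk hL)) (measurableSet_singleton c)
    rw [← measure_posteriorUpdate_eq hs h0 h1 (posterior_mem_Ico h0 h1 hL0 t x) c,
      ← lintegral_indicator_one hm]
    refine lintegral_congr fun y => ?_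
    simp [Set.indicator_apply, posterior_succ_update]
  rw [obsLaw_apply h0 h1 hB hBt, ← lintegral_indicator_one hB, ← lintegral_indicator_one hB,
    lintegral_postLaw_succ ν₀ ν₁ h0 e t (measurable_one.indicator hB),
    lintegral_preLaw_succ ν₀ ν₁ h1 e t (measurable_one.indicator hB)]
  simp [key ν₀ hs0, key ν₁ hs1]

/-- If `B` has mass, so does its post-change or its pre-change part. Either feeds the next
post-change law, the second with weight `θ`, and there a fresh `ν₁` observation moves the posterior
into the interval with positive probability. -/
theorem obsLaw_posterior_mem_Ioc_pos (h0 : 0 < θ) (h1 : θ < 1) (hL : Measurable L)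
    (hL0 : ∀ y, 0 ≤ L y) (hs1 : IsSpread ν₁ L) {e : E} {t : ℕ} {B : Set (ℕ → E)}
    (hB : MeasurableSet B) (hBt : IsHistory e t B) (hpos : 0 < obsLaw ν₀ ν₁ θ B) {l l' : ℝ}
    (hl : 0 ≤ l) (hll : l < l') (hl' : l' ≤ 1) :
    0 < obsLaw ν₀ ν₁ θ (B ∩ {x | posterior θ L (t + 1) x ∈ Set.Ioc l l'}) := by
  set D := B ∩ {x : ℕ → E | posterior θ L (t + 1) x ∈ Set.Ioc l l'} with hD
  have hDm : MeasurableSet D := hB.inter (measurable_posterior hL (t + 1) measurableSet_Ioc)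
  have hDt : IsHistory e (t + 1) D := fun x => by
    simp [hD, posterior_trunc e le_rfl, (hBt.mono (Nat.le_succ t)) x]
  rw [obsLaw_apply h0 h1 hDm hDt]
  refine lt_of_lt_of_le ?_ le_self_add
  set G : (ℕ → E) → ENNReal := fun x =>
    ∫⁻ y, D.indicator (1 : (ℕ → E) → ENNReal) (Function.update x t y) ∂ν₁ with hG
  have hGm : Measurable G := Measurable.lintegral_prod_right
    (f := fun x y => D.indicator (1 : (ℕ → E) → ENNReal) (Function.update x t y))
    ((measurable_one.indicator hDm).comp (measurable_update_pair t))
  have hGpos : ∀ x ∈ B, 0 < G x := by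
    intro x hx
    obtain ⟨a, b, ha, hab, hsub⟩ := exists_Ioo_subset_posteriorUpdate h0 h1
      (posterior_mem_Ico (θ := θ) h0 h1 hL0 t x) hl hll hl'
    refine (hs1.charge a b ha hab).trans_le ?_
    have hm : MeasurableSet {y | L y ∈ Set.Ioo a b} := hL measurableSet_Ioo
    rw [← lintegral_indicator_one hm]
    refine lintegral_mono fun y => ?_
    by_cases hy : L y ∈ Set.Ioo a b
    · have : Function.update x t y ∈ D :=
        ⟨(hBt.update_mem x y).2 hx, by
          simpa only [Set.mem_ofPred_eq, posterior_succ_update] using hsub _ hy⟩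
      rw [Set.indicator_of_mem this]
      exact Set.indicator_le_self _ _ y
    · rw [Set.indicator_of_notMem (show y ∉ {y | L y ∈ Set.Ioo a b} from hy)]
      exact zero_le
  have hposν : ∀ ν : Measure (ℕ → E), 0 < ν B → 0 < ∫⁻ x, G x ∂ν := by
    intro ν hν
    rw [lintegral_pos_iff_support hGm]
    exact hν.trans_le (measure_mono fun x hx => (hGpos x hx).ne')
  rw [← lintegral_indicator_one hDm,
    lintegral_postLaw_succ ν₀ ν₁ h0 e t (measurable_one.indicator hDm)]
  rw [obsLaw_apply h0 h1 hB hBt] at hpos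
  rcases (add_pos_iff.1 hpos) with h | h
  · exact (hposν _ h).trans_le le_self_add
  · exact (ENNReal.mul_pos (ENNReal.ofReal_pos.2 h0).ne' (hposν _ h).ne').trans_le le_add_self

end Posterior

/-! ### Consequences of the likelihood ratio assumption -/

section LikelihoodRatio

variable {E : Type*} [MeasurableSpace E]

/-- A positive density makes the law of `L` equivalent to Lebesgue measure on the positive half
line, which has these properties. -/
theorem isSpread_of_hasContPosDensity {ν : Measure E} {L : E → ℝ} (hL : Measurable L)
    (h : HasContPosDensity (ν.map L)) : IsSpread ν L := by
  obtain ⟨f, hfc, hfpos, hf⟩ := h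
  have hac : ν.map L ≪ volume.restrict (Set.Ioi 0) := hf ▸ withDensity_absolutelyContinuous _ _
  have hac' : volume.restrict (Set.Ioi 0) ≪ ν.map L := by
    rw [hf]
    refine withDensity_absolutelyContinuous'
      (hfc.aemeasurable measurableSet_Ioi).ennreal_ofReal ?_
    refine (ae_restrict_iff' measurableSet_Ioi).2 (Eventually.of_forall fun z hz => ?_)
    exact (ENNReal.ofReal_pos.2 (hfpos z hz)).ne'
  refine ⟨?_, fun c => ?_, fun a b ha hab => ?_⟩
  · have h1 : ν.map L (Set.Iic 0) = 0 := by
      refine hac ?_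
      rw [Measure.restrict_apply measurableSet_Iic, Set.Iic_inter_Ioi, Set.Ioc_self,
        measure_empty]
    rw [Measure.map_apply hL measurableSet_Iic] at h1
    exact measure_mono_null (fun y (hy : ¬ 0 < L y) => not_lt.1 hy) h1
  · have h1 : ν.map L {c} = 0 := by
      refine hac (measure_mono_null (fun z hz => hz) ?_)
      exact measure_singleton c
    rwa [Measure.map_apply hL (measurableSet_singleton c)] at h1
  · rw [pos_iff_ne_zero]
    intro h1
    have h2 : ν.map L (Set.Ioo a b) = 0 := by
      rw [Measure.map_apply hL measurableSet_Ioo]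
      exact h1
    have h3 := hac' h2
    have hsub : Set.Ioo a b ⊆ Set.Ioi 0 := fun z hz => ha.trans_lt hz.1
    rw [Measure.restrict_apply measurableSet_Ioo, Set.inter_eq_left.2 hsub, Real.volume_Ioo, ENNReal.ofReal_eq_zero] at h3
    linarith

variable {μ : Measure E} {p q : E → ℝ}

/-- Division by zero yields `0`, so positivity of `q / p` under `q` excludes `q > 0 = p`. Then `q =
p * (q / p)` almost everywhere. -/
theorem densityLaw_eq_withDensity (hp : IsDensity μ p) (hq : IsDensity μ q)
    (hpos : ∀ᵐ y ∂densityLaw μ q, 0 < q y / p y) :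
    densityLaw μ q = (densityLaw μ p).withDensity fun y => ENNReal.ofReal (q y / p y) := by
  have hqm := hq.measurable.ennreal_ofReal
  have h1 : ∀ᵐ y ∂μ, p y = 0 → q y = 0 := by
    rw [densityLaw, ae_withDensity_iff hqm] at hpos
    filter_upwards [hpos] with y hy hp0
    by_contra hne
    have := hy (ENNReal.ofReal_pos.2 (lt_of_le_of_ne (hq.nonneg y) (Ne.symm hne))).ne'
    simp [hp0] at this
  rw [densityLaw, densityLaw, ← withDensity_mul _ hp.measurable.ennreal_ofReal
    (f := fun y => ENNReal.ofReal (p y)) (g := fun y => ENNReal.ofReal (q y / p y))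
    (hq.measurable.div hp.measurable).ennreal_ofReal]
  refine withDensity_congr_ae ?_
  filter_upwards [h1] with y hy
  rw [Pi.mul_apply, ← ENNReal.ofReal_mul (hp.nonneg y)]
  congr 1
  by_cases h0 : p y = 0
  · simp [h0, hy h0]
  · field_simp

end LikelihoodRatio

/-! ### Limiting thresholds -/

section RealCrossing

variable {α : ℝ} {N M : ℝ → ℝ}

/-- Properties of the partial masses `N l` and the partial means `M l` below the level `l` of a
diffuse distribution of full support on the unit interval. -/
structure IsPartialMean (N M : ℝ → ℝ) : Prop where
  strictMonoOn : StrictMonoOn N (Set.Icc 0 1)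
  zero_left : N 0 = 0
  zero_right : M 0 = 0
  continuous_left : Continuous N
  continuous_right : Continuous M
  le_sub : ∀ l l', 0 ≤ l → l ≤ l' → l * (N l' - N l) ≤ M l' - M l
  sub_le : ∀ l l', 0 ≤ l → l ≤ l' → M l' - M l ≤ l' * (N l' - N l)

theorem IsPartialMean.pos (h : IsPartialMean N M) {l : ℝ} (h0 : 0 < l) (h1 : l ≤ 1) : 0 < N l := by
  rw [← h.zero_left]
  exact h.strictMonoOn ⟨le_rfl, zero_le_one⟩ ⟨h0.le, h1⟩ h0

/-- Strict monotonicity of `M / N`: the average below `l` is less than `l`, and the mass added above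
`l` has average at least `l`. -/
theorem IsPartialMean.mul_lt_mul (h : IsPartialMean N M) {l l' : ℝ} (h0 : 0 < l) (hl : l < l')
    (h1 : l' ≤ 1) : M l * N l' < M l' * N l := by
  have hN : N l < N l' := h.strictMonoOn ⟨h0.le, hl.le.trans h1⟩ ⟨(h0.trans hl).le, h1⟩ hl
  have hN2 := h.pos (half_pos h0) (by linarith)
  -- Strictness comes from the positive mass below `l / 2`.
  have hM : M l < l * N l := by
    have e1 := h.sub_le 0 (l / 2) le_rfl (half_pos h0).le
    have e2 := h.sub_le (l / 2) l (half_pos h0).le (half_lt_self h0).le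
    rw [h.zero_left, h.zero_right] at e1
    nlinarith
  have e3 := h.le_sub l l' h0.le hl.le
  have hN3 := h.pos h0 (hl.le.trans h1)
  nlinarith [mul_pos (sub_pos.2 hN) (sub_pos.2 hM), mul_le_mul_of_nonneg_right e3 hN3.le]

/-- The supremum of the levels at which the partial average is at most `α`. -/
noncomputable def crossingLevel (α : ℝ) (N M : ℝ → ℝ) : ℝ :=
  sSup {l : ℝ | l ∈ Set.Icc (0 : ℝ) 1 ∧ M l / N l ≤ α}

theorem IsPartialMean.isCrossing (h : IsPartialMean N M) (hα : 0 < α) (hα1 : α ≤ 1) :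
    IsCrossing α N M (crossingLevel α N M) := by
  have hbdd : BddAbove {l : ℝ | l ∈ Set.Icc (0 : ℝ) 1 ∧ M l / N l ≤ α} := ⟨1, fun l hl => hl.1.2⟩
  -- Values at most `α` average at most `α`, so the supremum is at least `α` and hence positive.
  have hmem : α ∈ {l : ℝ | l ∈ Set.Icc (0 : ℝ) 1 ∧ M l / N l ≤ α} := by
    refine ⟨⟨hα.le, hα1⟩, ?_⟩
    rw [div_le_iff₀ (h.pos hα hα1)]
    have := h.sub_le 0 α le_rfl hα.le
    rw [h.zero_left, h.zero_right] at this
    linarith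
  have hpos : 0 < crossingLevel α N M := hα.trans_le (le_csSup hbdd hmem)
  refine ⟨hpos, csSup_le ⟨α, hmem⟩ fun l hl => hl.1.2, h.strictMonoOn,
    h.continuous_left.continuousAt, fun l h0 hl => ?_, fun l hl h1 => ?_⟩
  · obtain ⟨l', hl', hll'⟩ := exists_lt_of_lt_csSup ⟨α, hmem⟩ hl
    have hN' := h.pos (h0.trans hll') hl'.1.2
    have hN := h.pos h0 (hll'.le.trans hl'.1.2)
    have e1 := (div_le_iff₀ hN').1 hl'.2
    have e2 := h.mul_lt_mul h0 hll' hl'.1.2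
    have e3 : M l * N l' < α * N l * N l' := by nlinarith
    exact lt_of_mul_lt_mul_right e3 hN'.le
  · by_contra hc
    refine absurd (le_csSup hbdd (show l ∈ _ from ⟨⟨(hpos.trans hl).le, h1⟩, ?_⟩)) (not_le.2 hl)
    rw [div_le_iff₀ (h.pos (hpos.trans hl) h1)]
    exact not_lt.1 hc

/-- By continuity the average at the crossing is at most `α` from the left, and at least `α` from
the right if the crossing is below `1`. A crossing at `1` means that nothing is cut off. -/
theorem IsPartialMean.div_crossingLevel (h : IsPartialMean N M) (hα : 0 < α) (hα1 : α ≤ 1) :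
    M (crossingLevel α N M) / N (crossingLevel α N M) = min (M 1 / N 1) α := by
  have hc := h.isCrossing hα hα1
  set lam := crossingLevel α N M
  have hN := h.pos hc.pos hc.le_one
  have h1 : M lam ≤ α * N lam := by
    refine le_of_tendsto_of_tendsto (f := M) (g := fun l => α * N l) (b := 𝓝[<] lam)
      h.continuous_right.continuousWithinAt
      (h.continuous_left.const_mul α).continuousWithinAt ?_
    filter_upwards [Ioo_mem_nhdsLT hc.pos] with l hl
    exact (hc.lt_of_lt l hl.1 hl.2).le
  rcases hc.le_one.lt_or_eq with hlt | heq
  · have h2 : α * N lam ≤ M lam := by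
      refine le_of_tendsto_of_tendsto (f := fun l => α * N l) (g := M) (b := 𝓝[>] lam)
        (h.continuous_left.const_mul α).continuousWithinAt
        h.continuous_right.continuousWithinAt ?_
      filter_upwards [Ioo_mem_nhdsGT hlt] with l hl
      exact (hc.lt_of_gt l hl.1 hl.2.le).le
    have h3 := hc.lt_of_gt 1 hlt le_rfl
    rw [min_eq_right ((le_div_iff₀ (h.pos one_pos le_rfl)).2 h3.le), le_antisymm h1 h2,
      mul_div_cancel_right₀ _ hN.ne']
  · rw [heq] at h1 ⊢
    rw [min_eq_left ((div_le_iff₀ (h.pos one_pos le_rfl)).2 h1)]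

end RealCrossing

/-! ### Conditional means given events, and their transfer to image measures -/

section ExpectGiven

variable {Ω Ω' : Type*} [MeasurableSpace Ω] [MeasurableSpace Ω']

theorem expectGiven_eq_div (P : Measure Ω) [IsFiniteMeasure P] (Y : Ω → ℝ) (A : Set Ω) :
    expectGiven P Y A = (∫ ω in A, Y ω ∂P) / P.real A := by
  rw [expectGiven, ProbabilityTheory.cond, integral_smul_measure, ENNReal.toReal_inv, smul_eq_mul, Measure.real,
    div_eq_inv_mul]

theorem expectGiven_comp {P : Measure Ω} [IsFiniteMeasure P] {f : Ω → Ω'} (hf : Measurable f)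
    {Y : Ω' → ℝ} (hY : Measurable Y) {A : Set Ω'} (hA : MeasurableSet A) :
    expectGiven P (fun ω => Y (f ω)) (f ⁻¹' A) = expectGiven (P.map f) Y A := by
  rw [expectGiven_eq_div, expectGiven_eq_div, setIntegral_map hA hY.aestronglyMeasurable
    hf.aemeasurable, map_measureReal_apply hf hA]

theorem measurableSet_le_forall {ι : Type*} [Countable ι] {V : ι → Ω → ℝ} (c : ι → ℝ)
    (hV : ∀ s, Measurable (V s)) : MeasurableSet {x | ∀ s, V s x ≤ c s} := by
  have : {x | ∀ s, V s x ≤ c s} = ⋂ s, {x | V s x ≤ c s} := by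
    ext x
    simp
  rw [this]
  exact MeasurableSet.iInter fun s => measurableSet_le (hV s) measurable_const

/-- The thresholds depend only on the law of the process. The induction is strong because each
threshold refers to all earlier ones. -/
theorem limitThreshold_comp {P : Measure Ω} [IsFiniteMeasure P] {f : Ω → Ω'} (hf : Measurable f)
    (α : ℝ) {V : ℕ → Ω' → ℝ} (hV : ∀ t, Measurable (V t)) (t : ℕ) :
    limitThreshold P α (fun t ω => V t (f ω)) t = limitThreshold (P.map f) α V t := by
  induction t using Nat.strong_induction_on with
  | _ t ih =>
    cases t with
    | zero => rw [limitThreshold, limitThreshold]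
    | succ t =>
      rw [limitThreshold, limitThreshold]
      congr 1
      ext l
      refine and_congr_right fun _ => ?_
      have hA : MeasurableSet {x | V (t + 1) x ≤ l ∧
          ∀ s : Fin (t + 1), V s x ≤ limitThreshold (P.map f) α V s} := by
        refine (measurableSet_le (hV _) measurable_const).inter ?_
        exact measurableSet_le_forall _ fun s => hV s
      rw [← expectGiven_comp hf (hV (t + 1)) hA]
      have : (f ⁻¹' {x | V (t + 1) x ≤ l ∧
          ∀ s : Fin (t + 1), V s x ≤ limitThreshold (P.map f) α V s}) =
          {ω | V (t + 1) (f ω) ≤ l ∧ ∀ s : Fin (t + 1), V s (f ω) ≤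
            limitThreshold P α (fun t ω => V t (f ω)) s} := by
        ext ω
        simp only [Set.mem_preimage, Set.mem_ofPred_eq]
        refine and_congr_right fun _ => forall_congr' fun s => ?_
        rw [ih s s.2]
      rw [this]

end ExpectGiven

section Split

variable {Ω : Type*} {A : Set Ω} {V : Ω → ℝ}

theorem inter_le_eq_union {l l' : ℝ} (h : l ≤ l') :
    A ∩ {ω | V ω ≤ l'} = (A ∩ {ω | V ω ≤ l}) ∪ (A ∩ {ω | V ω ∈ Set.Ioc l l'}) := by
  ext ω
  simp only [Set.mem_inter_iff, Set.mem_union, Set.mem_ofPred_eq, Set.mem_Ioc, ← and_or_left]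
  refine and_congr_right fun _ => ⟨fun h1 => ?_, fun h1 => ?_⟩
  · rcases le_or_gt (V ω) l with h2 | h2
    exacts [Or.inl h2, Or.inr ⟨h2, h1⟩]
  · rcases h1 with h2 | h2
    exacts [h2.trans h, h2.2]

theorem disjoint_le_Ioc {l l' : ℝ} :
    Disjoint (A ∩ {ω | V ω ≤ l}) (A ∩ {ω | V ω ∈ Set.Ioc l l'}) :=
  Set.disjoint_left.2 fun _ h1 h2 => absurd h1.2 (not_le.2 h2.2.1)

end Split

/-! ### Mass and mean of a bounded diffuse variable below a level -/

section PartialMean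

variable {Ω : Type*} [MeasurableSpace Ω]

/-- The mass of the part of `A` on which `V` is at most `l`. -/
noncomputable def partialMass (P : Measure Ω) (A : Set Ω) (V : Ω → ℝ) (l : ℝ) : ℝ :=
  P.real (A ∩ {ω | V ω ≤ l})

/-- The integral of `V` over the part of `A` on which `V` is at most `l`. -/
noncomputable def partialMean (P : Measure Ω) (A : Set Ω) (V : Ω → ℝ) (l : ℝ) : ℝ :=
  ∫ ω in A ∩ {ω | V ω ≤ l}, V ω ∂P

variable {P : Measure Ω} {A : Set Ω} {V : Ω → ℝ}

/-- Dominated convergence: the indicator is locally constant in `l` off the event `V = l`, which is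
null. -/
theorem continuous_integral_indicator_le (hV : Measurable V) (hatom : ∀ c, P {ω | V ω = c} = 0)
    {g : Ω → ℝ} (hg : Integrable g P) :
    Continuous fun l => ∫ ω, {ω | V ω ≤ l}.indicator g ω ∂P := by
  refine continuous_iff_continuousAt.2 fun l => ?_
  refine continuousAt_of_dominated (bound := fun ω => ‖g ω‖)
    (Eventually.of_forall fun l' => hg.aestronglyMeasurable.indicator
      (measurableSet_le hV measurable_const))
    (Eventually.of_forall fun l' => Eventually.of_forall fun ω =>
      norm_indicator_le_norm_self _ _) hg.norm ?_
  have h : ∀ᵐ ω ∂P, V ω ≠ l := by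
    rw [ae_iff]
    simpa using hatom l
  filter_upwards [h] with ω hω
  rcases lt_or_gt_of_ne hω with h1 | h1
  · refine (continuousAt_const (y := g ω)).congr ?_
    filter_upwards [lt_mem_nhds h1] with l' hl'
    rw [Set.indicator_of_mem (show ω ∈ {ω | V ω ≤ l'} from hl'.le)]
  · refine (continuousAt_const (y := (0 : ℝ))).congr ?_
    filter_upwards [gt_mem_nhds h1] with l' hl'
    rw [Set.indicator_of_notMem (show ω ∉ {ω | V ω ≤ l'} from not_le.2 hl')]

variable [IsFiniteMeasure P]

theorem isPartialMean (hA : MeasurableSet A) (hV : Measurable V) (hmem : ∀ ω, V ω ∈ Set.Icc 0 1)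
    (hatom : ∀ c, P {ω | V ω = c} = 0)
    (hpos : ∀ l l', 0 ≤ l → l < l' → l' ≤ 1 → 0 < P (A ∩ {ω | V ω ∈ Set.Ioc l l'})) :
    IsPartialMean (partialMass P A V) (partialMean P A V) := by
  have hint : Integrable V P := Integrable.of_bound hV.aestronglyMeasurable 1
    (Eventually.of_forall fun ω => by
      rw [Real.norm_eq_abs, abs_of_nonneg (hmem ω).1]
      exact (hmem ω).2)
  have hle : ∀ l, MeasurableSet {ω | V ω ≤ l} := fun l => measurableSet_le hV measurable_const
  have hIoc : ∀ l l', MeasurableSet (A ∩ {ω | V ω ∈ Set.Ioc l l'}) := fun l l' =>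
    hA.inter (hV measurableSet_Ioc)
  have hNsub : ∀ l l', l ≤ l' → partialMass P A V l' - partialMass P A V l =
      P.real (A ∩ {ω | V ω ∈ Set.Ioc l l'}) := fun l l' h => by
    rw [partialMass, partialMass, inter_le_eq_union h, measureReal_union disjoint_le_Ioc
      (hIoc l l')]
    ring
  have hMsub : ∀ l l', l ≤ l' → partialMean P A V l' - partialMean P A V l =
      ∫ ω in A ∩ {ω | V ω ∈ Set.Ioc l l'}, V ω ∂P := fun l l' h => by
    rw [partialMean, partialMean, inter_le_eq_union h, setIntegral_union disjoint_le_Ioc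
      (hIoc l l') hint.integrableOn hint.integrableOn]
    ring
  have hzero : P (A ∩ {ω | V ω ≤ 0}) = 0 :=
    measure_mono_null (fun ω hω => le_antisymm hω.2 (hmem ω).1) (hatom 0)
  refine ⟨fun l hl l' hl' h => ?_, ?_, ?_, ?_, ?_, fun l l' h0 h => ?_, fun l l' h0 h => ?_⟩
  · rw [← sub_pos, hNsub l l' h.le]
    exact ENNReal.toReal_pos (hpos l l' hl.1 h hl'.2).ne' (measure_ne_top _ _)
  · simp [partialMass, Measure.real, hzero]
  · rw [partialMean, Measure.restrict_eq_zero.2 hzero, integral_zero_measure]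
  · have := continuous_integral_indicator_le hV hatom ((integrable_const (1 : ℝ)).indicator hA)
    refine this.congr fun l => ?_
    rw [Set.indicator_indicator, integral_indicator ((hle l).inter hA), setIntegral_const,
      smul_eq_mul, mul_one, partialMass, Set.inter_comm]
  · have := continuous_integral_indicator_le hV hatom (hint.indicator hA)
    refine this.congr fun l => ?_
    rw [Set.indicator_indicator, integral_indicator ((hle l).inter hA), partialMean,
      Set.inter_comm]
  · rw [hNsub l l' h, hMsub l l' h, mul_comm, ← smul_eq_mul, ← setIntegral_const]
    exact setIntegral_mono_on (integrable_const _).integrableOn hint.integrableOn (hIoc l l')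
      fun ω hω => hω.2.1.le
  · rw [hNsub l l' h, hMsub l l' h, mul_comm, ← smul_eq_mul, ← setIntegral_const]
    exact setIntegral_mono_on hint.integrableOn (integrable_const _).integrableOn (hIoc l l')
      fun ω hω => hω.2.2

end PartialMean

/-! ### The limiting thresholds of a single stream -/

section Threshold

variable {E : Type*} [MeasurableSpace E] (ν₀ ν₁ : Measure E) (θ α : ℝ) (L : E → ℝ)

/-- The limiting thresholds of the posterior process of a single stream. -/
noncomputable def level (t : ℕ) : ℝ := limitThreshold (obsLaw ν₀ ν₁ θ) α (posterior θ L) t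

/-- The paths whose posterior probability stays below the limiting thresholds up to time `t`. -/
def survivors (t : ℕ) : Set (ℕ → E) := {x | ∀ s ≤ t, posterior θ L s x ≤ level ν₀ ν₁ θ α L s}

theorem survivors_succ (t : ℕ) : survivors ν₀ ν₁ θ α L (t + 1) =
    survivors ν₀ ν₁ θ α L t ∩ {x | posterior θ L (t + 1) x ≤ level ν₀ ν₁ θ α L (t + 1)} := by
  ext x
  simp only [survivors, Set.mem_inter_iff, Set.mem_ofPred_eq]
  exact ⟨fun h => ⟨fun s hs => h s (hs.trans (Nat.le_succ t)), h _ le_rfl⟩,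
    fun h s hs => (Nat.le_succ_iff.1 hs).elim (h.1 s) fun hst => hst ▸ h.2⟩

theorem survivors_zero : survivors ν₀ ν₁ θ α L 0 = Set.univ := by
  ext x
  simp [survivors, level, limitThreshold, posterior]

theorem isHistory_survivors (e : E) (t : ℕ) : IsHistory e t (survivors ν₀ ν₁ θ α L t) :=
  fun x => forall₂_congr fun s hs => by rw [posterior_trunc e hs]

variable {ν₀ ν₁ θ α L}

theorem measurableSet_survivors (hL : Measurable L) (t : ℕ) :
    MeasurableSet (survivors ν₀ ν₁ θ α L t) := by
  induction t with
  | zero => rw [survivors_zero]; exact MeasurableSet.univ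
  | succ t ih =>
    rw [survivors_succ]
    exact ih.inter (measurableSet_le (measurable_posterior hL _) measurable_const)

variable [IsProbabilityMeasure ν₀] [IsProbabilityMeasure ν₁]

theorem level_succ (h0 : 0 < θ) (h1 : θ < 1) (t : ℕ) :
    level ν₀ ν₁ θ α L (t + 1) = crossingLevel α
      (partialMass (obsLaw ν₀ ν₁ θ) (survivors ν₀ ν₁ θ α L t) (posterior θ L (t + 1)))
      (partialMean (obsLaw ν₀ ν₁ θ) (survivors ν₀ ν₁ θ α L t) (posterior θ L (t + 1))) := by
  have := isProbabilityMeasure_obsLaw ν₀ ν₁ h0 h1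
  rw [level, limitThreshold, crossingLevel]
  congr 1
  ext l
  refine and_congr_right fun _ => ?_
  rw [expectGiven_eq_div, partialMass, partialMean]
  have : {x | posterior θ L (t + 1) x ≤ l ∧ ∀ s : Fin (t + 1),
      posterior θ L s x ≤ limitThreshold (obsLaw ν₀ ν₁ θ) α (posterior θ L) s} =
      survivors ν₀ ν₁ θ α L t ∩ {x | posterior θ L (t + 1) x ≤ l} := by
    ext x
    simp only [survivors, level, Set.mem_inter_iff, Set.mem_ofPred_eq]
    exact ⟨fun h => ⟨fun s hs => h.2 ⟨s, Nat.lt_succ_of_le hs⟩, h.1⟩,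
      fun h => ⟨h.2, fun s => h.1 s (Nat.le_of_lt_succ s.2)⟩⟩
  rw [this]

theorem isPartialMean_survivors (h0 : 0 < θ) (h1 : θ < 1) (hL : Measurable L)
    (hL0 : ∀ y, 0 ≤ L y) (hs0 : IsSpread ν₀ L) (hs1 : IsSpread ν₁ L) {t : ℕ}
    (hpos : 0 < obsLaw ν₀ ν₁ θ (survivors ν₀ ν₁ θ α L t)) :
    IsPartialMean
      (partialMass (obsLaw ν₀ ν₁ θ) (survivors ν₀ ν₁ θ α L t) (posterior θ L (t + 1)))
      (partialMean (obsLaw ν₀ ν₁ θ) (survivors ν₀ ν₁ θ α L t) (posterior θ L (t + 1))) := by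
  have := isProbabilityMeasure_obsLaw ν₀ ν₁ h0 h1
  obtain ⟨e⟩ : Nonempty E := ν₀.nonempty_of_neZero
  refine isPartialMean (measurableSet_survivors hL t) (measurable_posterior hL _)
    (fun x => Set.Ico_subset_Icc_self (posterior_mem_Ico h0 h1 hL0 _ x))
    (obsLaw_posterior_eq h0 h1 hL hL0 hs0 hs1 e t) fun l l' hl hll hl' =>
      obsLaw_posterior_mem_Ioc_pos h0 h1 hL hL0 hs1 (measurableSet_survivors hL t)
        (isHistory_survivors ν₀ ν₁ θ α L e t) hpos hl hll hl'

/-- Positive mass and the value of the mean are proved together: positivity at `t` is what makes the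
crossing argument available at `t + 1`. The mean `a` becomes `θ + (1 - θ) a` with the new
observation and is then cut at `α`. -/
theorem obsLaw_survivors (h0 : 0 < θ) (h1 : θ < 1) (hα : 0 < α) (hα1 : α ≤ 1) (hL : Measurable L)
    (hL0 : ∀ y, 0 ≤ L y) (hs0 : IsSpread ν₀ L) (hs1 : IsSpread ν₁ L)
    (hν : ν₁ = ν₀.withDensity fun y => ENNReal.ofReal (L y)) (t : ℕ) :
    0 < obsLaw ν₀ ν₁ θ (survivors ν₀ ν₁ θ α L t) ∧
    (∫ x in survivors ν₀ ν₁ θ α L t, posterior θ L t x ∂obsLaw ν₀ ν₁ θ) /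
      (obsLaw ν₀ ν₁ θ).real (survivors ν₀ ν₁ θ α L t) = min (1 - (1 - θ) ^ t) α := by
  have := isProbabilityMeasure_obsLaw ν₀ ν₁ h0 h1
  obtain ⟨e⟩ : Nonempty E := ν₀.nonempty_of_neZero
  induction t with
  | zero => simp [survivors_zero, posterior, hα.le]
  | succ t ih =>
    have hpm := isPartialMean_survivors h0 h1 hL hL0 hs0 hs1 ih.1
    have hc := hpm.isCrossing hα hα1
    have hdiv := hpm.div_crossingLevel hα hα1
    rw [← level_succ h0 h1] at hc hdiv
    have hN1 := hpm.pos hc.pos hc.le_one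
    have hle1 : survivors ν₀ ν₁ θ α L t ∩ {x | posterior θ L (t + 1) x ≤ 1} =
        survivors ν₀ ν₁ θ α L t :=
      Set.inter_eq_left.2 fun x _ => (posterior_mem_Ico h0 h1 hL0 _ x).2.le
    simp only [partialMass, partialMean, hle1, ← survivors_succ] at hN1 hdiv
    refine ⟨(ENNReal.toReal_pos_iff.1 hN1).1, ?_⟩
    have hpos : 0 < (obsLaw ν₀ ν₁ θ).real (survivors ν₀ ν₁ θ α L t) :=
      ENNReal.toReal_pos ih.1.ne' (measure_ne_top _ _)
    rw [hdiv, setIntegral_posterior_succ h0 h1 hL hL0 hν (measurableSet_survivors hL t)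
      (isHistory_survivors ν₀ ν₁ θ α L e t), add_div, mul_div_cancel_right₀ _ hpos.ne',
      mul_div_assoc, ih.2]
    have hθ : (0 : ℝ) < 1 - θ := by linarith
    -- Before saturation the recursion reproduces the geometric formula; once the mean is `α`, it
    -- would rise to `θ + (1 - θ) α ≥ α` and is cut back.
    rcases le_total (1 - (1 - θ) ^ t) α with h | h
    · rw [min_eq_left h]
      congr 1
      ring
    · rw [min_eq_right h, min_eq_right (by nlinarith), min_eq_right]
      rw [pow_succ]
      nlinarith [pow_pos hθ t]

theorem isCrossing_survivors (h0 : 0 < θ) (h1 : θ < 1) (hα : 0 < α) (hα1 : α ≤ 1)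
    (hL : Measurable L) (hL0 : ∀ y, 0 ≤ L y) (hs0 : IsSpread ν₀ L) (hs1 : IsSpread ν₁ L)
    (hν : ν₁ = ν₀.withDensity fun y => ENNReal.ofReal (L y)) (t : ℕ) :
    IsCrossing α
      (partialMass (obsLaw ν₀ ν₁ θ) (survivors ν₀ ν₁ θ α L t) (posterior θ L (t + 1)))
      (partialMean (obsLaw ν₀ ν₁ θ) (survivors ν₀ ν₁ θ α L t) (posterior θ L (t + 1)))
      (level ν₀ ν₁ θ α L (t + 1)) := by
  rw [level_succ h0 h1]
  exact (isPartialMean_survivors h0 h1 hL hL0 hs0 hs1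
    (obsLaw_survivors h0 h1 hα hα1 hL hL0 hs0 hs1 hν t).1).isCrossing hα hα1

end Threshold

theorem min_one_sub_pow_eq_ite {θ α : ℝ} (h0 : 0 < θ) (h1 : θ < 1) (hα1 : α ≤ 1) (t : ℕ)
    [Decidable (α = 1 ∨ (t : ℝ) < Real.log (1 - α) / Real.log (1 - θ))] :
    min (1 - (1 - θ) ^ t) α =
      if α = 1 ∨ (t : ℝ) < Real.log (1 - α) / Real.log (1 - θ) then 1 - (1 - θ) ^ t else α := by
  have hθ : (0 : ℝ) < 1 - θ := by linarith
  -- The case `α = 1` is separate: `Real.log 0 = 0` makes the quotient `0` rather than `+∞`.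
  rcases hα1.eq_or_lt with rfl | hlt
  · rw [if_pos (Or.inl rfl), min_eq_left]
    linarith [pow_pos hθ t]
  · have hlog : Real.log (1 - θ) < 0 := Real.log_neg hθ (by linarith)
    have hiff : (t : ℝ) < Real.log (1 - α) / Real.log (1 - θ) ↔ 1 - α < (1 - θ) ^ t := by
      rw [lt_div_iff_of_neg hlog, ← Real.log_pow,
        Real.log_lt_log_iff (by linarith) (pow_pos hθ t)]
    by_cases h : 1 - α < (1 - θ) ^ t
    · rw [if_pos (Or.inr (hiff.2 h)), min_eq_left (by linarith)]
    · rw [if_neg, min_eq_right (by linarith)]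
      rintro (h2 | h2)
      exacts [hlt.ne h2, h (hiff.1 h2)]

/-! ### The information of the procedure -/

section FullInfo

variable {Ω E : Type*} [MeasurableSpace E] {K : ℕ} (X : Fin K → ℕ → Ω → E)

/-- The information in the observations of all streams up to time `t`. -/
@[reducible]
def fullInfo (e : E) (t : ℕ) : MeasurableSpace Ω :=
  MeasurableSpace.comap (fun ω (k : Fin K) => trunc e t (obsPath (X k) ω)) MeasurableSpace.pi

theorem fullInfo_mono (e : E) (t : ℕ) : fullInfo X e t ≤ fullInfo X e (t + 1) := by
  have h : (fun ω (k : Fin K) => trunc e t (obsPath (X k) ω)) =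
      (fun (z : Fin K → ℕ → E) k => trunc e t (z k)) ∘
        fun ω (k : Fin K) => trunc e (t + 1) (obsPath (X k) ω) := by
    funext ω k
    exact (trunc_trunc e (Nat.le_succ t) _).symm
  rw [fullInfo, h, ← MeasurableSpace.comap_comp]
  exact MeasurableSpace.comap_mono (measurable_iff_comap_le.1
    (measurable_pi_lambda _ fun k => (measurable_trunc e t).comp (measurable_pi_apply k)))

theorem measurable_fullInfo_obs (e : E) (t : ℕ) (k : Fin K) :
    Measurable[fullInfo X e (t + 1)] (X k (t + 1)) := by
  have h : X k (t + 1) = (fun z : Fin K → ℕ → E => z k t) ∘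
      fun ω (k : Fin K) => trunc e (t + 1) (obsPath (X k) ω) := by
    funext ω
    simp [trunc, obsPath]
  rw [h]
  exact ((measurable_pi_apply t).comp (measurable_pi_apply k)).comp
    (comap_measurable fun ω (k : Fin K) => trunc e (t + 1) (obsPath (X k) ω))

end FullInfo

/-! ### What the procedure knows: less than all observations, but the posterior of active streams -/

section Procedure

variable {Ω E : Type*} [mΩ : MeasurableSpace Ω] [mE : MeasurableSpace E] (P : Measure Ω) (α : ℝ)
  {K : ℕ} (τ : Fin K → Ω → ℕ∞) (X : Fin K → ℕ → Ω → E)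

theorem info_succ (t : ℕ) : info P α τ X (t + 1) =
    observe (info P α τ X t) (activeNext P α τ X t) fun k => X k (t + 1) := rfl

theorem info_le_info_succ (t : ℕ) : info P α τ X t ≤ info P α τ X (t + 1) := by
  rw [info_succ, observe, sup_assoc]
  exact le_sup_left

theorem comap_activeNext_le_info_succ (t : ℕ) :
    MeasurableSpace.comap (activeNext P α τ X t) ⊤ ≤ info P α τ X (t + 1) := by
  rw [info_succ, observe]
  exact le_sup_right.trans le_sup_left

theorem measurableSet_info_of_mem_activeNext (t : ℕ) (k : Fin K) {B : Set E}
    (hB : MeasurableSet B) : MeasurableSet[info P α τ X (t + 1)]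
      {ω | k ∈ activeNext P α τ X t ω ∧ X k (t + 1) ω ∈ B} := by
  have h : MeasurableSpace.generateFrom
      {A | ∃ (k : Fin K) (B : Set E), MeasurableSet B ∧
        A = {ω | k ∈ activeNext P α τ X t ω ∧ X k (t + 1) ω ∈ B}} ≤ info P α τ X (t + 1) := by
    rw [info_succ, observe]
    exact le_sup_right
  exact h _ (MeasurableSpace.measurableSet_generateFrom ⟨k, B, hB, rfl⟩)

theorem measurable_activeNext (t : ℕ) :
    @Measurable _ _ (info P α τ X t) ⊤ (activeNext P α τ X t) := by
  cases t with
  | zero => exact measurable_const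
  | succ t =>
    refine measurable_oneStepUpdate (m := info P α τ X (t + 1)) α ?_ fun k => ?_
    · exact measurable_iff_comap_le.2 (comap_activeNext_le_info_succ P α τ X t)
    · exact stronglyMeasurable_condExp.measurable

theorem measurableSet_mem_activeNext (t : ℕ) (k : Fin K) :
    MeasurableSet[info P α τ X t] {ω | k ∈ activeNext P α τ X t ω} :=
  measurable_activeNext P α τ X t (show MeasurableSet[⊤] {S : Finset (Fin K) | k ∈ S} from trivial)

theorem activeNext_succ_subset (t : ℕ) (ω : Ω) :
    activeNext P α τ X (t + 1) ω ⊆ activeNext P α τ X t ω := oneStepUpdate_subset _ _ _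

theorem info_le_fullInfo (e : E) (t : ℕ) : info P α τ X t ≤ fullInfo X e t := by
  induction t with
  | zero => exact bot_le
  | succ t ih =>
    have ih' := ih.trans (fullInfo_mono X e t)
    rw [info_succ, observe]
    refine sup_le (sup_le ih' ?_) (MeasurableSpace.generateFrom_le ?_)
    · exact (measurable_iff_comap_le.1 (measurable_activeNext P α τ X t)).trans ih'
    · rintro _ ⟨k, B, hB, rfl⟩
      exact (ih' _ (measurableSet_mem_activeNext P α τ X t k)).inter
        (measurable_fullInfo_obs X e t k hB)

theorem fullInfo_le (hX : ∀ k, Measurable (obsPath (X k))) (e : E) (t : ℕ) :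
    fullInfo X e t ≤ mΩ :=
  measurable_iff_comap_le.1
    (measurable_pi_lambda _ fun k => (measurable_trunc e t).comp (hX k))

variable {θ : ℝ} {L : E → ℝ}

/-- The posterior probability of a stream is determined by the information of the procedure as
long as the stream is active. -/
theorem measurable_indicator_posterior [Nonempty E] (hL : Measurable L) (k : Fin K) (t : ℕ) :
    Measurable[info P α τ X t] ({ω | k ∈ activeNext P α τ X (t - 1) ω}.indicator
      fun ω => posterior θ L t (obsPath (X k) ω)) := by
  classical
  induction t with
  -- The streams observed at time `t` form `activeNext (t - 1)`. At `t = 0` the truncated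
  -- subtraction is harmless since the posterior is `0`.
  | zero =>
    have : ({ω | k ∈ activeNext P α τ X (0 - 1) ω}.indicator
        fun ω => posterior θ L 0 (obsPath (X k) ω)) = fun _ => 0 := by
      funext ω
      simp [posterior]
    rw [this]
    exact measurable_const
  | succ t ih =>
    let e : E := Classical.arbitrary E
    set c := {ω | k ∈ activeNext P α τ X t ω} with hc
    have hcm : MeasurableSet[info P α τ X (t + 1)] c :=
      info_le_info_succ P α τ X t _ (measurableSet_mem_activeNext P α τ X t k)
    -- An unobserved value is replaced by a fixed point, so that the observation becomes measurable
    -- for the procedure.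
    have hg : Measurable[info P α τ X (t + 1)] fun ω => if ω ∈ c then X k (t + 1) ω else e := by
      intro B hB
      have : (fun ω => if ω ∈ c then X k (t + 1) ω else e) ⁻¹' B =
          {ω | k ∈ activeNext P α τ X t ω ∧ X k (t + 1) ω ∈ B} ∪ (cᶜ ∩ {_ω | e ∈ B}) := by
        ext ω
        by_cases h : k ∈ activeNext P α τ X t ω <;> simp [hc, h]
      rw [this]
      exact (measurableSet_info_of_mem_activeNext P α τ X t k hB).union
        (hcm.compl.inter (MeasurableSet.const _))
    have hz := (measurable_posteriorUpdate (θ := θ)).comp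
      ((ih.mono (info_le_info_succ P α τ X t) le_rfl).prodMk (hL.comp hg))
    have h2 := hz.indicator hcm
    have e1 : (c.indicator ((fun z : ℝ × ℝ => posteriorUpdate θ z.1 z.2) ∘ fun ω =>
        ({ω | k ∈ activeNext P α τ X (t - 1) ω}.indicator
          (fun ω => posterior θ L t (obsPath (X k) ω)) ω,
        (L ∘ fun ω => if ω ∈ c then X k (t + 1) ω else e) ω))) =
        c.indicator fun ω => posterior θ L (t + 1) (obsPath (X k) ω) := by
      funext ω
      by_cases h : ω ∈ c
      · have h' : ω ∈ {ω | k ∈ activeNext P α τ X (t - 1) ω} := by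
          cases t with
          | zero => exact h
          | succ t => exact activeNext_succ_subset P α τ X t ω h
        rw [Set.indicator_of_mem h, Set.indicator_of_mem h]
        simp only [Function.comp, Set.indicator_of_mem h', if_pos h]
        rfl
      · rw [Set.indicator_of_notMem h, Set.indicator_of_notMem h]
    rw [e1] at h2
    exact h2

end Procedure

/-! ### The posterior of one stream given the observations of all streams -/

section Bayes

variable {Ω E : Type*} [mΩ : MeasurableSpace Ω] [mE : MeasurableSpace E] {P : Measure Ω}
  {ν₀ ν₁ : Measure E} {θ : ℝ}
  {T : ℕ → Ω → ℕ} {Y : ℕ → Ω → ℕ → E}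

theorem IsStreamModel.lintegral_box (h : IsStreamModel ν₀ ν₁ P θ T Y) {K : ℕ} (e : E) (t : ℕ)
    (k : Fin K) {g : ℕ × (ℕ → E) → ENNReal} (hg : Measurable g) {C : Fin K → Set (ℕ → E)}
    (hC : ∀ j, MeasurableSet (C j)) :
    ∫⁻ ω in {ω | ∀ j : Fin K, trunc e t (Y j ω) ∈ C j}, g (T k ω, Y k ω) ∂P =
      (∫⁻ z in {z | trunc e t z.2 ∈ C k}, g z ∂jointLaw ν₀ ν₁ θ) *
        ∏ j ∈ Finset.univ.erase k, jointLaw ν₀ ν₁ θ {z | trunc e t z.2 ∈ C j} := by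
  classical
  have hpair : ∀ j, Measurable fun ω => (T j ω, Y j ω) := fun j =>
    (h.measurable_changePoint j).prodMk (h.measurable_obs j)
  have hD : ∀ j, MeasurableSet {z : ℕ × (ℕ → E) | trunc e t z.2 ∈ C j} := fun j =>
    (measurable_trunc e t).comp measurable_snd (hC j)
  set φ : Fin K → ℕ × (ℕ → E) → ENNReal := fun j =>
    {z | trunc e t z.2 ∈ C j}.indicator (if j = k then g else 1) with hφ
  have hφm : ∀ j, Measurable (φ j) := fun j => by
    refine Measurable.indicator ?_ (hD j)
    split_ifs
    exacts [hg, measurable_one]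
  have hind : iIndepFun (fun (j : Fin K) ω => φ j (T j ω, Y j ω)) P :=
    (h.indep.precomp Fin.val_injective).comp φ hφm
  have h1 := lintegral_prod_eq_prod_lintegral_of_indepFun Finset.univ
    (fun (j : Fin K) ω => φ j (T j ω, Y j ω)) hind fun j => (hφm j).comp (hpair j)
  have h2 : ∀ j : Fin K, ∫⁻ ω, φ j (T j ω, Y j ω) ∂P = ∫⁻ z, φ j z ∂jointLaw ν₀ ν₁ θ := fun j => by
    rw [← h.map_eq j, lintegral_map (hφm j) (hpair j)]
  simp only [h2] at h1
  rw [← Finset.mul_prod_erase _ _ (Finset.mem_univ k)] at h1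
  have hset : MeasurableSet {ω | ∀ j : Fin K, trunc e t (Y j ω) ∈ C j} := by
    have : {ω | ∀ j : Fin K, trunc e t (Y j ω) ∈ C j} =
        ⋂ j : Fin K, (fun ω => (T j ω, Y j ω)) ⁻¹' {z | trunc e t z.2 ∈ C j} := by
      ext ω
      simp
    rw [this]
    exact MeasurableSet.iInter fun j => hpair j (hD j)
  rw [← lintegral_indicator hset, ← lintegral_indicator (hD k)]
  convert h1 using 1
  · refine lintegral_congr fun ω => ?_
    by_cases hω : ∀ j : Fin K, trunc e t (Y j ω) ∈ C j
    · rw [Set.indicator_of_mem (show ω ∈ {ω | ∀ j : Fin K, trunc e t (Y j ω) ∈ C j} from hω),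
        Finset.prod_eq_single_of_mem k (Finset.mem_univ k)]
      · simp [hφ, hω k]
      · intro j _ hj
        simp [hφ, hω j, hj]
    · rw [Set.indicator_of_notMem
        (show ω ∉ {ω | ∀ j : Fin K, trunc e t (Y j ω) ∈ C j} from hω)]
      obtain ⟨j, hj⟩ := not_forall.1 hω
      rw [Finset.prod_eq_zero (Finset.mem_univ j)]
      simp [hφ, hj]
  · congr 1
    · simp [hφ]
    · refine Finset.prod_congr rfl fun j hj => ?_
      rw [← lintegral_indicator_one (hD j)]
      simp only [hφ, if_neg (Finset.ne_of_mem_erase hj)]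

/-- Two functions of a single stream that agree on average given the history of that stream agree
on average given the observations of all streams. -/
theorem IsStreamModel.setLIntegral_congr [IsProbabilityMeasure P]
    (h : IsStreamModel ν₀ ν₁ P θ T Y) {K : ℕ} (e : E) (t : ℕ) (k : Fin K)
    {g g' : ℕ × (ℕ → E) → ENNReal} (hg : Measurable g) (hg' : Measurable g') (hg1 : ∀ z, g z ≤ 1)
    (heq : ∀ C : Set (ℕ → E), MeasurableSet C →
      ∫⁻ z in {z | trunc e t z.2 ∈ C}, g z ∂jointLaw ν₀ ν₁ θ =
        ∫⁻ z in {z | trunc e t z.2 ∈ C}, g' z ∂jointLaw ν₀ ν₁ θ)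
    {C : Set (Fin K → ℕ → E)} (hC : MeasurableSet C) :
    ∫⁻ ω in {ω | (fun j : Fin K => trunc e t (Y j ω)) ∈ C}, g (T k ω, Y k ω) ∂P =
      ∫⁻ ω in {ω | (fun j : Fin K => trunc e t (Y j ω)) ∈ C}, g' (T k ω, Y k ω) ∂P := by
  have hH : Measurable fun ω (j : Fin K) => trunc e t (Y j ω) :=
    measurable_pi_lambda _ fun j => (measurable_trunc e t).comp (h.measurable_obs j)
  have hmap : ∀ (g : ℕ × (ℕ → E) → ENNReal) {C : Set (Fin K → ℕ → E)}, MeasurableSet C →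
      (P.withDensity fun ω => g (T k ω, Y k ω)).map (fun ω (j : Fin K) => trunc e t (Y j ω)) C =
      ∫⁻ ω in {ω | (fun j : Fin K => trunc e t (Y j ω)) ∈ C}, g (T k ω, Y k ω) ∂P := by
    intro g C hC
    rw [Measure.map_apply hH hC, withDensity_apply _ (hH hC)]
    rfl
  have hfin : IsFiniteMeasure (P.withDensity fun ω => g (T k ω, Y k ω)) :=
    isFiniteMeasure_withDensity (ne_of_lt ((lintegral_mono fun ω => hg1 _).trans_lt (by simp)))
  have hbox : ∀ s : Fin K → Set (ℕ → E), (∀ j, MeasurableSet (s j)) →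
      (P.withDensity fun ω => g (T k ω, Y k ω)).map (fun ω (j : Fin K) => trunc e t (Y j ω))
        (Set.univ.pi s) =
      (P.withDensity fun ω => g' (T k ω, Y k ω)).map (fun ω (j : Fin K) => trunc e t (Y j ω))
        (Set.univ.pi s) := by
    intro s hs
    rw [hmap g (MeasurableSet.univ_pi hs), hmap g' (MeasurableSet.univ_pi hs)]
    have e1 : {ω | (fun j : Fin K => trunc e t (Y j ω)) ∈ Set.univ.pi s} =
        {ω | ∀ j : Fin K, trunc e t (Y j ω) ∈ s j} := by
      ext ω
      simp
    rw [e1, h.lintegral_box e t k hg hs, h.lintegral_box e t k hg' hs, heq _ (hs k)]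
  rw [← hmap g hC, ← hmap g' hC]
  congr 1
  -- On boxes independence factors out the other streams; boxes form a π-system generating the
  -- product σ-algebra.
  refine ext_of_generate_finite _ generateFrom_pi.symm isPiSystem_pi ?_ ?_
  · rintro _ ⟨s, hs, rfl⟩
    exact hbox s fun j => hs j (Set.mem_univ j)
  · have := hbox (fun _ => Set.univ) fun _ => MeasurableSet.univ
    rwa [Set.pi_univ] at this

variable [IsProbabilityMeasure ν₀] [IsProbabilityMeasure ν₁] {L : E → ℝ}

theorem IsStreamModel.measure_inter_lt [IsProbabilityMeasure P] (h : IsStreamModel ν₀ ν₁ P θ T Y)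
    (h0 : 0 < θ) (h1 : θ < 1) (hL : Measurable L) (hL0 : ∀ y, 0 ≤ L y)
    (hν : ν₁ = ν₀.withDensity fun y => ENNReal.ofReal (L y)) {K : ℕ} (e : E) (t : ℕ) (k : Fin K)
    {C : Set (Fin K → ℕ → E)} (hC : MeasurableSet C) :
    P.real ({ω | T k ω < t} ∩ {ω | (fun j : Fin K => trunc e t (Y j ω)) ∈ C}) =
      ∫ ω in {ω | (fun j : Fin K => trunc e t (Y j ω)) ∈ C}, posterior θ L t (Y k ω) ∂P := by
  have hlt : MeasurableSet {z : ℕ × (ℕ → E) | z.1 < t} :=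
    measurableSet_lt measurable_fst measurable_const
  have hV := measurable_posterior (θ := θ) hL t
  have key := h.setLIntegral_congr (g := {z | z.1 < t}.indicator 1)
    (g' := fun z => ENNReal.ofReal (posterior θ L t z.2)) e t k (measurable_one.indicator hlt)
    (hV.comp measurable_snd).ennreal_ofReal
    (fun z => Set.indicator_le_self _ _ z) (fun B hB => ?_) hC
  · have e1 : ∀ ω, ({z : ℕ × (ℕ → E) | z.1 < t}.indicator (1 : ℕ × (ℕ → E) → ENNReal))
        (T k ω, Y k ω) = {ω | T k ω < t}.indicator 1 ω := fun ω => rfl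
    simp only [e1] at key
    rw [lintegral_indicator_one (measurableSet_lt (h.measurable_changePoint k) measurable_const),
      Measure.restrict_apply
        (measurableSet_lt (h.measurable_changePoint k) measurable_const)] at key
    rw [integral_eq_lintegral_of_nonneg_ae
      (Eventually.of_forall fun ω => (posterior_mem_Ico h0 h1 hL0 t _).1)
      (hV.comp (h.measurable_obs k)).aestronglyMeasurable, Measure.real, key]
  · have hBm : MeasurableSet {z : ℕ × (ℕ → E) | trunc e t z.2 ∈ B} :=
      (measurable_trunc e t).comp measurable_snd hB
    rw [lintegral_indicator_one hlt, Measure.restrict_apply hlt]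
    have e1 : {z : ℕ × (ℕ → E) | z.1 < t} ∩ {z | trunc e t z.2 ∈ B} =
        {z | z.1 < t ∧ trunc e t z.2 ∈ B} := rfl
    rw [e1, jointLaw_lt_inter ν₀ ν₁ e t hB, ← lintegral_indicator_one hB,
      lintegral_postLaw h0 h1 hL hL0 hν e t (measurable_one.indicator hB), obsLaw,
      lintegral_map (f := fun x => B.indicator 1 (trunc e t x) *
        ENNReal.ofReal (posterior θ L t x)) (((measurable_one.indicator hB).comp (measurable_trunc e t)).mul
        hV.ennreal_ofReal) measurable_snd, ← lintegral_indicator hBm]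
    refine lintegral_congr fun z => ?_
    by_cases hz : trunc e t z.2 ∈ B <;> simp [hz]

end Bayes

/-! ### Posterior probabilities and the local false non-discovery rate of the procedure -/

section CondExp

variable {Ω : Type*} {F mΩ : MeasurableSpace Ω} {P : Measure Ω} [IsProbabilityMeasure P]

/-- A localized characterization: `g` has the right integrals over all sets of `F` but is
`F`-measurable only on `c`. Multiplying by the indicator of `c` gives an honest conditional
expectation. It is used with `c` the event that a stream is observed. -/
theorem condExp_eq_of_indicator_measurable (hF : F ≤ mΩ) {f g : Ω → ℝ} (hf : Integrable f P)
    (hg : Integrable g P) {c : Set Ω} (hc : MeasurableSet[F] c)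
    (hm : Measurable[F] (c.indicator g))
    (h : ∀ s, MeasurableSet[F] s → ∫ ω in s, g ω ∂P = ∫ ω in s, f ω ∂P) :
    ∀ᵐ ω ∂P, ω ∈ c → condExp F P f ω = g ω := by
  have hZ : c.indicator g =ᵐ[P] condExp F P (c.indicator f) := by
    refine ae_eq_condExp_of_forall_setIntegral_eq hF (hf.indicator (hF _ hc))
      (fun s _ _ => (hg.indicator (hF _ hc)).integrableOn) (fun s hs _ => ?_)
      hm.stronglyMeasurable.aestronglyMeasurable
    rw [setIntegral_indicator (hF _ hc), setIntegral_indicator (hF _ hc)]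
    exact h _ (MeasurableSet.inter hs hc)
  filter_upwards [hZ, condExp_indicator hf hc] with ω h2 h3 hω
  rw [Set.indicator_of_mem hω] at h2 h3
  rw [h2, h3]

theorem measurableSet_changePoint_lt {σ : Ω → ℕ∞} (hσ : Measurable σ) (t : ℕ) :
    MeasurableSet {ω | σ ω < (t : ℕ∞)} :=
  hσ (Set.to_countable (Set.Iio (t : ℕ∞))).measurableSet

theorem integrable_indicator_changePoint {σ : Ω → ℕ∞} (hσ : Measurable σ) (t : ℕ) :
    Integrable ({ω | σ ω < (t : ℕ∞)}.indicator fun _ => (1 : ℝ)) P :=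
  (integrable_const 1).indicator (measurableSet_changePoint_lt hσ t)

/-- The weights `1(k ∈ S) / (|S| ∨ 1)` are bounded and known to `F`, so they pull out of the
conditional expectation. -/
theorem condExp_fnpNext (hF : F ≤ mΩ) {K : ℕ} {τ : Fin K → Ω → ℕ∞} (hτ : ∀ k, Measurable (τ k))
    {S : Ω → Finset (Fin K)} (hS : @Measurable _ _ F ⊤ S) (t : ℕ) :
    ∀ᵐ ω ∂P, condExp F P (fnpNext τ S t) ω =
      (∑ k ∈ S ω, postProb P τ F k t ω) / (max (S ω).card 1 : ℕ) := by
  classical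
  set c : Fin K → Ω → ℝ := fun k ω =>
    (fun U : Finset (Fin K) => if k ∈ U then ((max U.card 1 : ℕ) : ℝ)⁻¹ else 0) (S ω) with hc
  have hcm : ∀ k, StronglyMeasurable[F] (c k) := fun k => Measurable.stronglyMeasurable
    fun B _ => hS (show MeasurableSet[⊤] ((fun U : Finset (Fin K) =>
      if k ∈ U then ((max U.card 1 : ℕ) : ℝ)⁻¹ else 0) ⁻¹' B) from trivial)
  have hcb : ∀ k ω, ‖c k ω‖ ≤ 1 := fun k ω => by
    simp only [hc]
    split_ifs
    · rw [norm_inv, Real.norm_natCast]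
      exact inv_le_one_of_one_le₀ (by exact_mod_cast le_max_right _ _)
    · simp
  set f : Fin K → Ω → ℝ := fun k => {ω | τ k ω < (t : ℕ∞)}.indicator fun _ => (1 : ℝ) with hf
  have hfi : ∀ k, Integrable (f k) P := fun k => integrable_indicator_changePoint (hτ k) t
  have hsum : ∀ (g : Fin K → Ω → ℝ) ω, ∑ k, c k ω * g k ω =
      (∑ k ∈ S ω, g k ω) / (max (S ω).card 1 : ℕ) := by
    intro g ω
    rw [div_eq_mul_inv, Finset.sum_mul]
    refine (Finset.sum_subset (Finset.subset_univ (S ω)) fun k _ hk => ?_).symm.trans ?_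
    · simp [hc, hk]
    · refine Finset.sum_congr rfl fun k hk => ?_
      simp only [hc, if_pos hk, mul_comm]
  have hfnp : fnpNext τ S t = ∑ k, c k * f k := by
    funext ω
    rw [fnpNext, Finset.sum_apply, Finset.card_filter]
    push_cast
    simp only [Pi.mul_apply]
    rw [hsum]
    push_cast
    simp only [hf, Set.indicator_apply, Set.mem_ofPred_eq]
  have hprod : ∀ k ∈ Finset.univ, Integrable (c k * f k) P := fun k _ =>
    (hfi k).bdd_mul ((hcm k).mono hF).aestronglyMeasurable (Eventually.of_forall (hcb k))
  have hpull : ∀ᵐ ω ∂P, ∀ k, condExp F P (c k * f k) ω = c k ω * condExp F P (f k) ω :=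
    ae_all_iff.2 fun k => condExp_stronglyMeasurable_mul_of_bound hF (hcm k) (hfi k) 1
      (Eventually.of_forall (hcb k))
  filter_upwards [condExp_finsetSum hprod F, hpull] with ω e1 e3
  rw [hfnp, e1, Finset.sum_apply]
  simp only [e3]
  exact hsum _ ω

end CondExp

/-! ### Identification of the posterior probabilities used by the procedure -/

section PostProb

variable {Ω E : Type*} [mΩ : MeasurableSpace Ω] [mE : MeasurableSpace E] {P : Measure Ω}
  {ν₀ ν₁ : Measure E} [IsProbabilityMeasure ν₀] {θ : ℝ} {τ : ℕ → Ω → ℕ∞}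
  {X : ℕ → ℕ → Ω → E} {L : E → ℝ}

theorem IsStreamModel.info_le
    (h : IsStreamModel ν₀ ν₁ P θ (fun k ω => (τ k ω).toNat) fun k => obsPath (X k)) (α : ℝ)
    (K t : ℕ) : info P α (fun k : Fin K => τ k) (fun k : Fin K => X k) t ≤ mΩ := by
  obtain ⟨e⟩ : Nonempty E := ν₀.nonempty_of_neZero
  exact (info_le_fullInfo P α _ _ e t).trans (fullInfo_le _ (fun k => h.measurable_obs k) e t)

variable [IsProbabilityMeasure P] [IsProbabilityMeasure ν₁]

theorem IsStreamModel.postProb_eq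
    (h : IsStreamModel ν₀ ν₁ P θ (fun k ω => (τ k ω).toNat) fun k => obsPath (X k))
    (hτ : ∀ k, Measurable (τ k)) (htop : ∀ k, ∀ᵐ ω ∂P, τ k ω ≠ ⊤) (h0 : 0 < θ) (h1 : θ < 1)
    (hL : Measurable L) (hL0 : ∀ y, 0 ≤ L y)
    (hν : ν₁ = ν₀.withDensity fun y => ENNReal.ofReal (L y)) (α : ℝ) {K : ℕ} (k : Fin K) (t : ℕ) :
    ∀ᵐ ω ∂P, k ∈ activeNext P α (fun k : Fin K => τ k) (fun k : Fin K => X k) (t - 1) ω →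
      postProb P (fun k : Fin K => τ k)
        (info P α (fun k : Fin K => τ k) (fun k : Fin K => X k) t) k t ω =
      posterior θ L t (obsPath (X k) ω) := by
  have hE : Nonempty E := ν₀.nonempty_of_neZero
  let e : E := Classical.arbitrary E
  have hc : MeasurableSet[info P α (fun k : Fin K => τ k) (fun k : Fin K => X k) t]
      {ω | k ∈ activeNext P α (fun k : Fin K => τ k) (fun k : Fin K => X k) (t - 1) ω} := by
    have := measurableSet_mem_activeNext P α (fun k : Fin K => τ k) (fun k : Fin K => X k) (t - 1) k
    cases t with
    | zero => exact this
    | succ t => exact info_le_info_succ P α _ _ t _ this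
  have hVint : Integrable (fun ω => posterior θ L t (obsPath (X k) ω)) P := by
    refine Integrable.of_bound
      ((measurable_posterior hL t).comp (h.measurable_obs k)).aestronglyMeasurable 1
      (Eventually.of_forall fun ω => ?_)
    have := posterior_mem_Ico (θ := θ) h0 h1 hL0 t (obsPath (X k) ω)
    rw [Real.norm_eq_abs, abs_of_nonneg this.1]
    exact this.2.le
  have hae : {ω | τ k ω < (t : ℕ∞)} =ᵐ[P] {ω | (τ k ω).toNat < t} := by
    filter_upwards [htop k] with ω hω
    refine propext ?_
    change τ k ω < (t : ℕ∞) ↔ (τ k ω).toNat < t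
    conv_lhs => rw [← ENat.natCast_toNat hω]
    exact Nat.cast_lt
  refine condExp_eq_of_indicator_measurable (h.info_le α K t)
    (integrable_indicator_changePoint (hτ k) t) hVint hc
    (measurable_indicator_posterior P α (fun k : Fin K => τ k) (fun k : Fin K => X k) hL k t)
    fun s hs => ?_
  -- An event known to the procedure is an event of all observations, where Bayes' formula for
  -- stream `k` applies.
  obtain ⟨C, hC, rfl⟩ := info_le_fullInfo P α (fun k : Fin K => τ k) (fun k : Fin K => X k) e t s hs
  have e2 := h.measure_inter_lt h0 h1 hL hL0 hν e t k hC
  rw [setIntegral_indicator (measurableSet_changePoint_lt (hτ k) t), setIntegral_const, smul_eq_mul,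
    mul_one, Set.inter_comm]
  exact e2.symm.trans (measureReal_congr (hae.symm.inter (ae_eq_refl _)))

theorem IsStreamModel.lfnrNext_eq
    (h : IsStreamModel ν₀ ν₁ P θ (fun k ω => (τ k ω).toNat) fun k => obsPath (X k))
    (hτ : ∀ k, Measurable (τ k)) (htop : ∀ k, ∀ᵐ ω ∂P, τ k ω ≠ ⊤) (h0 : 0 < θ) (h1 : θ < 1)
    (hL : Measurable L) (hL0 : ∀ y, 0 ≤ L y)
    (hν : ν₁ = ν₀.withDensity fun y => ENNReal.ofReal (L y)) (α : ℝ) (K t : ℕ) :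
    ∀ᵐ ω ∂P, lfnrNext P α (fun k : Fin K => τ k) (fun k : Fin K => X k) t ω =
      (∑ k ∈ activeNext P α (fun k : Fin K => τ k) (fun k : Fin K => X k) t ω,
        posterior θ L t (obsPath (X k) ω)) /
      (max (activeNext P α (fun k : Fin K => τ k) (fun k : Fin K => X k) t ω).card 1 : ℕ) := by
  have hW := ae_all_iff.2 fun k : Fin K => h.postProb_eq hτ htop h0 h1 hL hL0 hν α k t
  filter_upwards [hW, condExp_fnpNext (h.info_le α K t) (fun k : Fin K => hτ k)
    (measurable_activeNext P α (fun k : Fin K => τ k) (fun k : Fin K => X k) t) t] with ω e1 e2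
  rw [lfnrNext, e2]
  congr 1
  refine Finset.sum_congr rfl fun k hk => e1 k ?_
  cases t with
  | zero => exact hk
  | succ t => exact activeNext_succ_subset P α _ _ t ω hk

end PostProb

/-! ### Limits as the number of streams grows -/

section Limit

variable {Ω E : Type*} [MeasurableSpace Ω] [MeasurableSpace E] {P : Measure Ω}
  {ν₀ ν₁ : Measure E} {θ : ℝ} {T : ℕ → Ω → ℕ} {Y : ℕ → Ω → ℕ → E}

theorem IsStreamModel.map_obs (h : IsStreamModel ν₀ ν₁ P θ T Y) (k : ℕ) :
    P.map (Y k) = obsLaw ν₀ ν₁ θ := by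
  rw [obsLaw, ← h.map_eq k, Measure.map_map measurable_snd
    ((h.measurable_changePoint k).prodMk (h.measurable_obs k))]
  rfl

theorem IsStreamModel.ae_tendsto_sum_div (h : IsStreamModel ν₀ ν₁ P θ T Y)
    {f : (ℕ → E) → ℝ} (hf : Measurable f) (hint : Integrable f (obsLaw ν₀ ν₁ θ)) :
    ∀ᵐ ω ∂P, Tendsto (fun K : ℕ => (∑ k ∈ Finset.range K, f (Y k ω)) / K) atTop
      (𝓝 (∫ x, f x ∂obsLaw ν₀ ν₁ θ)) := by
  have h1 := strong_law_ae_real (μ := P) (fun k ω => f (Y k ω))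
    (by
      rw [← h.map_obs 0] at hint
      exact hint.comp_measurable (h.measurable_obs 0))
    (fun i j hij => (h.indep.indepFun hij).comp (hf.comp measurable_snd) (hf.comp measurable_snd))
    (fun i => IdentDistrib.comp
      ⟨(h.measurable_obs i).aemeasurable, (h.measurable_obs 0).aemeasurable, by
        rw [h.map_obs, h.map_obs]⟩ hf)
  rwa [← h.map_obs 0, integral_map (h.measurable_obs 0).aemeasurable hf.aestronglyMeasurable]

variable {L : E → ℝ} {α : ℝ}

theorem integral_survivors_indicator (hL : Measurable L) (t : ℕ) (r : ℝ) (g : (ℕ → E) → ℝ) :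
    ∫ x, (survivors ν₀ ν₁ θ α L t).indicator
      ({x | posterior θ L (t + 1) x ≤ r}.indicator g) x ∂obsLaw ν₀ ν₁ θ =
    ∫ x in survivors ν₀ ν₁ θ α L t ∩ {x | posterior θ L (t + 1) x ≤ r}, g x ∂obsLaw ν₀ ν₁ θ := by
  rw [Set.indicator_indicator, integral_indicator ((measurableSet_survivors hL t).inter
    (measurableSet_le (measurable_posterior hL _) measurable_const))]

variable [IsProbabilityMeasure ν₀] [IsProbabilityMeasure ν₁]

/-- Simultaneous laws of large numbers for the posterior probabilities of the streams. -/
theorem IsStreamModel.ae_forall_tendsto (h : IsStreamModel ν₀ ν₁ P θ T Y) (h0 : 0 < θ)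
    (h1 : θ < 1) (hL : Measurable L) (hL0 : ∀ y, 0 ≤ L y) (α : ℝ) :
    ∀ᵐ ω ∂P, ∀ t : ℕ,
      (∀ r : ℚ, Tendsto (fun K : ℕ => (∑ k ∈ Finset.range K,
        {k | Y k ω ∈ survivors ν₀ ν₁ θ α L t}.indicator (fun k =>
          {k | posterior θ L (t + 1) (Y k ω) ≤ r}.indicator (fun _ => (1 : ℝ)) k) k) / K) atTop
        (𝓝 (partialMass (obsLaw ν₀ ν₁ θ) (survivors ν₀ ν₁ θ α L t) (posterior θ L (t + 1)) r))) ∧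
      (∀ r : ℚ, Tendsto (fun K : ℕ => (∑ k ∈ Finset.range K,
        {k | Y k ω ∈ survivors ν₀ ν₁ θ α L t}.indicator (fun k =>
          {k | posterior θ L (t + 1) (Y k ω) ≤ r}.indicator
            (fun k => posterior θ L (t + 1) (Y k ω)) k) k) / K) atTop
        (𝓝 (partialMean (obsLaw ν₀ ν₁ θ) (survivors ν₀ ν₁ θ α L t) (posterior θ L (t + 1)) r))) ∧
      Tendsto (fun K : ℕ => (∑ k ∈ Finset.range K,
        {k | Y k ω ∈ survivors ν₀ ν₁ θ α L t}.indicator (fun _ => (1 : ℝ)) k) / K) atTop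
        (𝓝 ((obsLaw ν₀ ν₁ θ).real (survivors ν₀ ν₁ θ α L t))) ∧
      Tendsto (fun K : ℕ => (∑ k ∈ Finset.range K,
        {k | Y k ω ∈ survivors ν₀ ν₁ θ α L t}.indicator
          (fun k => posterior θ L t (Y k ω)) k) / K) atTop
        (𝓝 (∫ x in survivors ν₀ ν₁ θ α L t, posterior θ L t x ∂obsLaw ν₀ ν₁ θ)) := by
  have := isProbabilityMeasure_obsLaw ν₀ ν₁ h0 h1
  have hA : ∀ t, MeasurableSet (survivors ν₀ ν₁ θ α L t) := measurableSet_survivors hL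
  have hle : ∀ (t : ℕ) (r : ℝ), MeasurableSet {x | posterior θ L (t + 1) x ≤ r} := fun t r =>
    measurableSet_le (measurable_posterior hL _) measurable_const
  have hi : ∀ t, Integrable (posterior θ L t) (obsLaw ν₀ ν₁ θ) := fun t =>
    integrable_posterior h0 h1 hL hL0 t _
  have h1i : Integrable (fun _ : ℕ → E => (1 : ℝ)) (obsLaw ν₀ ν₁ θ) := integrable_const 1
  refine ae_all_iff.2 fun t => ?_
  refine (ae_all_iff.2 fun r : ℚ => ?_).and ((ae_all_iff.2 fun r : ℚ => ?_).and
    (Eventually.and ?_ ?_))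
  · have := h.ae_tendsto_sum_div ((measurable_const.indicator (hle t r)).indicator (hA t))
      ((h1i.indicator (hle t r)).indicator (hA t))
    rw [integral_survivors_indicator hL, setIntegral_const, smul_eq_mul, mul_one] at this
    exact this
  · have := h.ae_tendsto_sum_div
      (((measurable_posterior (θ := θ) hL (t + 1)).indicator (hle t r)).indicator (hA t))
      (((hi (t + 1)).indicator (hle t r)).indicator (hA t))
    rw [integral_survivors_indicator hL] at this
    exact this
  · have := h.ae_tendsto_sum_div (measurable_const.indicator (hA t)) (h1i.indicator (hA t))
    rw [integral_indicator (hA t), setIntegral_const, smul_eq_mul, mul_one] at this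
    exact this
  · have := h.ae_tendsto_sum_div ((measurable_posterior (θ := θ) hL t).indicator (hA t))
      ((hi t).indicator (hA t))
    rw [integral_indicator (hA t)] at this
    exact this

variable [IsProbabilityMeasure P] {τ : ℕ → Ω → ℕ∞} {X : ℕ → ℕ → Ω → E}

/-- On the event where all the laws of large numbers and posterior identities hold, the argument is
deterministic: by induction on `t`, one update carries negligible discrepancy to the next time. -/
theorem IsStreamModel.ae_forall_empirical
    (h : IsStreamModel ν₀ ν₁ P θ (fun k ω => (τ k ω).toNat) fun k => obsPath (X k))
    (hτ : ∀ k, Measurable (τ k)) (htop : ∀ k, ∀ᵐ ω ∂P, τ k ω ≠ ⊤) (h0 : 0 < θ) (h1 : θ < 1)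
    (hα : 0 < α) (hα1 : α ≤ 1) (hL : Measurable L) (hL0 : ∀ y, 0 ≤ L y)
    (hs0 : IsSpread ν₀ L) (hs1 : IsSpread ν₁ L)
    (hν : ν₁ = ν₀.withDensity fun y => ENNReal.ofReal (L y)) :
    ∀ᵐ ω ∂P, ∀ t, EmpiricalLimit (fun k => posterior θ L (t + 1) (obsPath (X k) ω))
      {k | obsPath (X k) ω ∈ survivors ν₀ ν₁ θ α L t}
      (fun K => activeNext P α (fun k : Fin K => τ k) (fun k : Fin K => X k) t ω)
      (fun K k => postProb P (fun k : Fin K => τ k)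
        (info P α (fun k : Fin K => τ k) (fun k : Fin K => X k) (t + 1)) k (t + 1) ω)
      (partialMass (obsLaw ν₀ ν₁ θ) (survivors ν₀ ν₁ θ α L t) (posterior θ L (t + 1)))
      (partialMean (obsLaw ν₀ ν₁ θ) (survivors ν₀ ν₁ θ α L t) (posterior θ L (t + 1))) := by
  have hW := ae_all_iff.2 fun t => ae_all_iff.2 fun K => ae_all_iff.2 fun k : Fin K =>
    h.postProb_eq hτ htop h0 h1 hL hL0 hν α k (t + 1)
  filter_upwards [hW, h.ae_forall_tendsto h0 h1 hL hL0 α] with ω hW hlim t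
  have step : ∀ t, Tendsto (fun K => (discrepancy
      (activeNext P α (fun k : Fin K => τ k) (fun k : Fin K => X k) t ω)
      {k | obsPath (X k) ω ∈ survivors ν₀ ν₁ θ α L t} : ℝ) / K) atTop (𝓝 0) →
      EmpiricalLimit (fun k => posterior θ L (t + 1) (obsPath (X k) ω))
      {k | obsPath (X k) ω ∈ survivors ν₀ ν₁ θ α L t}
      (fun K => activeNext P α (fun k : Fin K => τ k) (fun k : Fin K => X k) t ω)
      (fun K k => postProb P (fun k : Fin K => τ k)
        (info P α (fun k : Fin K => τ k) (fun k : Fin K => X k) (t + 1)) k (t + 1) ω)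
      (partialMass (obsLaw ν₀ ν₁ θ) (survivors ν₀ ν₁ θ α L t) (posterior θ L (t + 1)))
      (partialMean (obsLaw ν₀ ν₁ θ) (survivors ν₀ ν₁ θ α L t) (posterior θ L (t + 1))) :=
    fun t hd => ⟨fun k => Set.Ico_subset_Icc_self (posterior_mem_Ico h0 h1 hL0 _ _),
      fun K k hk => hW t K k hk, hd, (hlim t).1, (hlim t).2.1⟩
  refine step t ?_
  induction t with
  | zero =>
    have : ∀ K : ℕ, discrepancy
        (activeNext P α (fun k : Fin K => τ k) (fun k : Fin K => X k) 0 ω)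
        {k | obsPath (X k) ω ∈ survivors ν₀ ν₁ θ α L 0} = 0 := fun K => by
      simp [discrepancy, activeNext, procedure, survivors_zero]
    simp [this]
  | succ t ih =>
    have := (step t ih).tendsto_discrepancy_oneStepUpdate hα
      (isCrossing_survivors h0 h1 hα hα1 hL hL0 hs0 hs1 hν t)
    rw [survivors_succ]
    exact this

end Limit

theorem vSeq_eq_posterior {E : Type*} (p q : E → ℝ) (θ : ℝ) (x : ℕ → E) (t : ℕ) :
    vSeq p q θ x t = posterior θ (fun y => q y / p y) t fun i => x (i + 1) := by
  induction t with
  | zero => rfl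
  | succ t ih => rw [vSeq, ih]; rfl

end ChangePoint

/-! ### Transfer to the model and the three limits -/

open ChangePoint
theorem theorem2 {Ω E : Type*} [MeasurableSpace Ω] [MeasurableSpace E]
    (P : Measure Ω) [IsProbabilityMeasure P] (μ : Measure E) (p q : E → ℝ) (θ α : ℝ)
    (hα_pos : 0 < α) (hα_le : α ≤ 1)
    (τ : ℕ → Ω → ℕ∞) (X : ℕ → ℕ → Ω → E)
    (hmodel : ∀ K : ℕ, IsModel P μ p q θ (fun k : Fin K => τ k) (fun k : Fin K => X k))
    (hratio : LikelihoodRatioAssumption μ p q)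
    (V : ℕ → Ω → ℝ) (hV : V = fun t ω => vSeq p q θ (fun s => X 0 s ω) t)
    (lam : ℕ → ℝ) (hlam : lam = limitThreshold P α V)
    (t : ℕ) (ht : 1 ≤ t) :
    (∀ᵐ ω ∂P, Tendsto
      (fun K : ℕ => threshold P α (fun k : Fin K => τ k) (fun k : Fin K => X k) t ω)
      atTop (𝓝 (lam t))) ∧
    (∀ᵐ ω ∂P, Tendsto
      (fun K : ℕ => lfnrNext P α (fun k : Fin K => τ k) (fun k : Fin K => X k) t ω)
      atTop (𝓝 (expectGiven P (V t) {ω' | ∀ s ≤ t, V s ω' ≤ lam s}))) ∧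
    (expectGiven P (V t) {ω | ∀ s ≤ t, V s ω ≤ lam s} =
      if α = 1 ∨ (t : ℝ) < Real.log (1 - α) / Real.log (1 - θ) then 1 - (1 - θ) ^ t else α) ∧
    (∀ᵐ ω ∂P, Tendsto
      (fun K : ℕ =>
        ((activeNext P α (fun k : Fin K => τ k) (fun k : Fin K => X k) t ω).card : ℝ) / K)
      atTop (𝓝 (P.real {ω' | ∀ s, 1 ≤ s → s ≤ t → V s ω' ≤ lam s}))) := by
  have hM := hmodel 0
  have h0 := hM.theta_pos
  have h1 := hM.theta_lt_one
  have := isProbabilityMeasure_densityLaw hM.density_pre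
  have := isProbabilityMeasure_densityLaw hM.density_post
  have h := isStreamModel_of_isModel hmodel
  have hτ : ∀ k, Measurable (τ k) := fun k =>
    (hmodel (k + 1)).measurable_changePoint (Fin.last k)
  have htop : ∀ k, ∀ᵐ ω ∂P, τ k ω ≠ ⊤ := fun k =>
    (hmodel (k + 1)).ae_changePoint_ne_top (Fin.last k)
  set L : E → ℝ := fun y => q y / p y with hLdef
  have hL : Measurable L := hM.density_post.measurable.div hM.density_pre.measurable
  have hL0 : ∀ y, 0 ≤ L y := fun y => div_nonneg (hM.density_post.nonneg y)
    (hM.density_pre.nonneg y)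
  have hs0 : IsSpread (densityLaw μ p) L := isSpread_of_hasContPosDensity hL hratio.1
  have hs1 : IsSpread (densityLaw μ q) L := isSpread_of_hasContPosDensity hL hratio.2
  have hν := densityLaw_eq_withDensity hM.density_pre hM.density_post hs1.pos
  have := isProbabilityMeasure_obsLaw (densityLaw μ p) (densityLaw μ q) h0 h1
  have hVp : V = fun t ω => posterior θ L t (obsPath (X 0) ω) := by
    rw [hV]
    funext t ω
    exact vSeq_eq_posterior p q θ _ t
  have hY := h.measurable_obs 0
  have hlev : lam = level (densityLaw μ p) (densityLaw μ q) θ α L := by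
    funext s
    rw [hlam, hVp, limitThreshold_comp hY α (measurable_posterior hL), h.map_obs]
    rfl
  set A := survivors (densityLaw μ p) (densityLaw μ q) θ α L with hAdef
  have hAm : ∀ t, MeasurableSet (A t) := measurableSet_survivors hL
  have hset : {ω | ∀ s ≤ t, V s ω ≤ lam s} = obsPath (X 0) ⁻¹' A t := by
    rw [hVp, hlev]
    rfl
  have hset' : {ω | ∀ s, 1 ≤ s → s ≤ t → V s ω ≤ lam s} = obsPath (X 0) ⁻¹' A t := by
    rw [← hset]
    ext ω
    refine ⟨fun hω s hs => ?_, fun hω s _ hs => hω s hs⟩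
    -- The constraint at time `0` is void, since `V_0 = 0` and `λ_0 = 1`.
    rcases Nat.eq_zero_or_pos s with rfl | hpos
    · rw [hlam, hV, limitThreshold]
      simp [vSeq]
    · exact hω s hpos hs
  have hexp : expectGiven P (V t) {ω | ∀ s ≤ t, V s ω ≤ lam s} =
      (∫ x in A t, posterior θ L t x ∂obsLaw (densityLaw μ p) (densityLaw μ q) θ) /
        (obsLaw (densityLaw μ p) (densityLaw μ q) θ).real (A t) := by
    rw [hset, hVp, expectGiven_comp hY (measurable_posterior hL t) (hAm t), h.map_obs,
      expectGiven_eq_div]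
  have hreal : P.real {ω' | ∀ s, 1 ≤ s → s ≤ t → V s ω' ≤ lam s} =
      (obsLaw (densityLaw μ p) (densityLaw μ q) θ).real (A t) := by
    rw [hset', ← h.map_obs 0, map_measureReal_apply hY (hAm t)]
  obtain ⟨hApos, hdiv⟩ := obsLaw_survivors h0 h1 hα_pos hα_le hL hL0 hs0 hs1 hν t
  have hApos' : 0 < (obsLaw (densityLaw μ p) (densityLaw μ q) θ).real (A t) :=
    ENNReal.toReal_pos hApos.ne' (measure_ne_top _ _)
  have hemp := h.ae_forall_empirical hτ htop h0 h1 hα_pos hα_le hL hL0 hs0 hs1 hν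
  have hlim := h.ae_forall_tendsto h0 h1 hL hL0 α
  have hcard : ∀ᵐ ω ∂P, Tendsto (fun K : ℕ =>
      ((activeNext P α (fun k : Fin K => τ k) (fun k : Fin K => X k) t ω).card : ℝ) / K) atTop
      (𝓝 ((obsLaw (densityLaw μ p) (densityLaw μ q) θ).real (A t))) := by
    filter_upwards [hemp, hlim] with ω e1 e2
    simpa using tendsto_sum_div_of_discrepancy (e1 t).tendsto_discrepancy
      (g := fun _ => 1) (by simp) (e2 t).2.2.1
  refine ⟨?_, ?_, ?_, ?_⟩
  · obtain ⟨s, rfl⟩ : ∃ s, t = s + 1 := ⟨t - 1, by omega⟩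
    filter_upwards [hemp] with ω e1
    rw [hlev]
    exact (e1 s).tendsto_sup hα_pos (isCrossing_survivors h0 h1 hα_pos hα_le hL hL0 hs0 hs1 hν s)
  · rw [hexp]
    have hlf := ae_all_iff.2 fun K => h.lfnrNext_eq hτ htop h0 h1 hL hL0 hν α K t
    filter_upwards [hemp, hlim, hcard, hlf] with ω e1 e2 e3 e4
    have e5 := tendsto_sum_div_of_discrepancy (e1 t).tendsto_discrepancy
      (g := fun k => posterior θ L t (obsPath (X k) ω))
      (fun k => Set.Ico_subset_Icc_self (posterior_mem_Ico h0 h1 hL0 _ _)) (e2 t).2.2.2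
    -- The rate is a quotient of two averages over the active set. The limiting proportion is
    -- positive, so the set is eventually nonempty and the maximum with `1` disappears.
    refine (e5.div e3 hApos'.ne').congr' ?_
    filter_upwards [e3.eventually_const_lt hApos', eventually_gt_atTop 0] with K hK hK0
    have hK0' : (0 : ℝ) < K := Nat.cast_pos.2 hK0
    have hc : 1 ≤ (activeNext P α (fun k : Fin K => τ k) (fun k : Fin K => X k) t ω).card := by
      rw [Nat.one_le_iff_ne_zero]
      intro hz
      simp [hz] at hK
    rw [e4 K, max_eq_left hc, Pi.div_apply, div_div_div_cancel_right₀ hK0'.ne']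
  · rw [hexp, hdiv]
    exact min_one_sub_pow_eq_ite h0 h1 hα_le t
  · rw [hreal]
    exact hcard
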